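/- For $\tau$ in the upper half plane $\mathbb{H}$ and $r\in\mathbb{Q}$ write $q^r=e^{2\pi i r\tau}$. Let $$X(\tau)=\frac{q^{7/4}}{q^2-1}\left(1-q^{-3/2}+\cfrac{a_0}{b_0+\cfrac{a_1}{b_1+\cfrac{a_2}{b_2+\ddots}}}\right),$$ where $a_k=(q^{1/4}-q^{3k-1/4})(q^{-7/4}-q^{3k+7/4})$ and $b_k=(1-q^{-3/2})(1+q^{3k+3})$ for $k\ge 0$, be the continued fraction of order six, and let $w(\tau)=X(\tau)X(3\tau)$. Let $\eta(\tau)=q^{1/24}\prod_{n\ge1}(1-q^n)$. A modular function on $\Gamma_0(N)$ is a meromorphic function on $\mathbb{H}$ that is invariant under $\Gamma_0(N)$ and meromorphic at all cusps $r\in\mathbb{Q}\cup\{\infty\}$; its order at $r=\gamma\infty$, $\gamma\in\mathrm{SL}_2(\mathbb{Z})$, is the order at $0$ of $f\circ\gamma$ as a Laurent series in $q^{1/h}$, where $h$ is the width of the cusp $r$. Then: 1. For every $\tau\in\mathbb{H}$ the continued fraction converges, and $$X(\tau)=q^{1/4}\prod_{n=1}^{\infty}\frac{(1-q^{6n-1})(1-q^{6n-5})}{(1-q^{6n-2})(1-q^{6n-4})}.$$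 2. For every $\tau\in\mathbb{H}$, $$w(\tau)=\frac{\eta(\tau)\,\eta(18\tau)^2}{\eta(2\tau)^2\,\eta(9\tau)}.$$ 3. $w$ is a modular function on $\Gamma_0(18)$ and generates the field $A_0(\Gamma_0(18))$ of all modular functions on $\Gamma_0(18)$ over $\mathbb{C}$, that is, $A_0(\Gamma_0(18))=\mathbb{C}(w)$. 4. $w$ is holomorphic and has no zeros on $\mathbb{H}$. At a cusp $r$ its order is $1$ if $r$ is equivalent to $\infty$ under $\Gamma_0(18)$, $-1$ if $r$ is equivalent to $1/2$, and $0$ otherwise. -/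

import Mathlib

open Filter Topology UpperHalfPlane
open scoped MatrixGroups ModularForm

noncomputable section

namespace OrderSix

/-! ### The continued fraction of order six -/

/-- The fractional power `q ^ r = exp (2 π i r z)` of `q = exp (2 π i z)`. -/
def qPow (z : ℂ) (r : ℚ) : ℂ := Complex.exp (2 * Real.pi * Complex.I * r * z)

/-- The infinite continued fraction
`(1 - q^(-3/2)) + a₀ / (b₀ + a₁ / (b₁ + ⋯))` with
`a_k = (q^(1/4) - q^(3k-1/4)) (q^(-7/4) - q^(3k+7/4))` and
`b_k = (1 - q^(-3/2)) (1 + q^(3(k+1)))`. -/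
def contFrac (z : ℂ) : GenContFract ℂ where
  h := 1 - qPow z (-3 / 2)
  s := Stream'.Seq.ofStream fun k : ℕ ↦
    { a := (qPow z (1 / 4) - qPow z (3 * k - 1 / 4)) *
        (qPow z (-7 / 4) - qPow z (3 * k + 7 / 4))
      b := (1 - qPow z (-3 / 2)) * (1 + qPow z (3 * (k + 1))) }

/-- The `n`-th approximant of `X(z)`: the `n`-th convergent of the continued fraction, multiplied
by `q^(7/4) / (q^2 - 1)`. -/
def approxX (z : ℂ) (n : ℕ) : ℂ :=
  qPow z (7 / 4) / (qPow z 2 - 1) * (contFrac z).convs n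

/-- The continued fraction of order six, as the limit of its approximants. -/
def X (z : ℂ) : ℂ := limUnder atTop (approxX z)

/-- The `n`-th factor, `n ≥ 1`, of the product expansion of `X`:
`(1 - q^(6n-1)) (1 - q^(6n-5)) / ((1 - q^(6n-2)) (1 - q^(6n-4)))`. -/
def factorX (z : ℂ) (n : ℕ) : ℂ :=
  (1 - qPow z (6 * n - 1)) * (1 - qPow z (6 * n - 5)) /
    ((1 - qPow z (6 * n - 2)) * (1 - qPow z (6 * n - 4)))

/-- `w(τ) = X(τ) X(3τ)`. -/
def w (τ : ℍ) : ℂ := X τ * X (3 * τ)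

/-! ### Modular functions on `Γ₀(N)` -/

/-- The width of the cusp `γ ∞` of `Γ₀(N)`: the least `h ≥ 1` for which `γ T^h γ⁻¹ ∈ Γ₀(N)`,
where `T` is the translation `τ ↦ τ + 1`. -/
def cuspWidth (N : ℕ) (γ : SL(2, ℤ)) : ℕ :=
  sInf {h : ℕ | 0 < h ∧ γ * ModularGroup.T ^ h * γ⁻¹ ∈ CongruenceSubgroup.Gamma0 N}

/-- The function `τ ↦ f (γ τ)` expressed in the local parameter `exp (2 π i τ / h)` at `∞`, where
`h` is the width of the cusp `γ ∞`. -/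
def expansionAtCusp (N : ℕ) (f : ℍ → ℂ) (γ : SL(2, ℤ)) : ℂ → ℂ :=
  UpperHalfPlane.cuspFunction (cuspWidth N γ) fun τ ↦ f (γ • τ)

/-- Modular functions on `Γ₀(N)`. The values at the poles are irrelevant. -/
structure IsModularFunction (N : ℕ) (f : ℍ → ℂ) : Prop where
  meromorphic : MeromorphicOn (f ∘ ofComplex) {z : ℂ | 0 < z.im}
  invariant : ∀ γ ∈ CongruenceSubgroup.Gamma0 N, ∀ τ : ℍ, f (γ • τ) = f τ
  meromorphic_cusps : ∀ γ : SL(2, ℤ), MeromorphicAt (expansionAtCusp N f γ) 0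

/-- `f` has order `n` at the cusp `r ∈ ℚ ∪ {∞}` of `Γ₀(N)`. -/
def HasOrderAtCusp (N : ℕ) (f : ℍ → ℂ) (r : OnePoint ℚ) (n : ℤ) : Prop :=
  ∀ γ : SL(2, ℤ), Matrix.SpecialLinearGroup.mapGL ℚ γ • (OnePoint.infty : OnePoint ℚ) = r →
    MeromorphicAt (expansionAtCusp N f γ) 0 ∧
      meromorphicOrderAt (expansionAtCusp N f γ) 0 = n

/-- Equivalence of the cusps `r` and `s` under `Γ₀(N)`. -/
def CuspEquiv (N : ℕ) (r s : OnePoint ℚ) : Prop :=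
  ∃ γ ∈ CongruenceSubgroup.Gamma0 N, Matrix.SpecialLinearGroup.mapGL ℚ γ • r = s

/-! ### The field of modular functions on `Γ₀(N)` -/

/-- Functions on `ℍ` modulo equality outside a closed discrete set. -/
abbrev FunModDiscrete : Type := Germ (codiscrete ℍ) ℂ

instance algebraFunModDiscrete : Algebra ℂ FunModDiscrete :=
  Algebra.ofModule
    (fun c x y ↦ by
      induction x using Germ.inductionOn with | _ f
      induction y using Germ.inductionOn with | _ g
      exact congrArg (fun u : ℍ → ℂ ↦ (u : FunModDiscrete)) (smul_mul_assoc c f g))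
    (fun c x y ↦ by
      induction x using Germ.inductionOn with | _ f
      induction y using Germ.inductionOn with | _ g
      exact congrArg (fun u : ℍ → ℂ ↦ (u : FunModDiscrete)) (mul_smul_comm c f g))

theorem meromorphicAt_cusp_congr {F G : ℂ → ℂ} (hF : MeromorphicAt F 0)
    (h : ∀ q, q ≠ 0 → F q = G q) : MeromorphicAt G 0 :=
  hF.congr (eventually_nhdsWithin_of_forall h)

theorem expansionAtCusp_apply (N : ℕ) (f : ℍ → ℂ) (γ : SL(2, ℤ)) {q : ℂ} (hq : q ≠ 0) :
    expansionAtCusp N f γ q =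
      f (γ • ofComplex (Function.Periodic.invQParam (cuspWidth N γ) q)) :=
  Function.Periodic.cuspFunction_eq_of_nonzero _ _ hq

theorem isModularFunction_const (N : ℕ) (c : ℂ) : IsModularFunction N fun _ ↦ c where
  meromorphic := MeromorphicOn.const c
  invariant _ _ _ := rfl
  meromorphic_cusps γ := meromorphicAt_cusp_congr (MeromorphicAt.const c 0)
    fun q hq ↦ by rw [expansionAtCusp_apply N _ γ hq]

theorem IsModularFunction.add {N : ℕ} {f g : ℍ → ℂ} (hf : IsModularFunction N f)
    (hg : IsModularFunction N g) : IsModularFunction N (f + g) where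
  meromorphic := hf.meromorphic.add hg.meromorphic
  invariant γ hγ τ := by
    simp only [Pi.add_apply, hf.invariant γ hγ, hg.invariant γ hγ]
  meromorphic_cusps γ := meromorphicAt_cusp_congr
    ((hf.meromorphic_cusps γ).add (hg.meromorphic_cusps γ))
    fun q hq ↦ by simp [expansionAtCusp_apply N _ γ hq]

theorem IsModularFunction.mul {N : ℕ} {f g : ℍ → ℂ} (hf : IsModularFunction N f)
    (hg : IsModularFunction N g) : IsModularFunction N (f * g) where
  meromorphic := hf.meromorphic.mul hg.meromorphic
  invariant γ hγ τ := by
    simp only [Pi.mul_apply, hf.invariant γ hγ, hg.invariant γ hγ]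
  meromorphic_cusps γ := meromorphicAt_cusp_congr
    ((hf.meromorphic_cusps γ).mul (hg.meromorphic_cusps γ))
    fun q hq ↦ by simp [expansionAtCusp_apply N _ γ hq]

theorem IsModularFunction.inv {N : ℕ} {f : ℍ → ℂ} (hf : IsModularFunction N f) :
    IsModularFunction N f⁻¹ where
  meromorphic := hf.meromorphic.inv
  invariant γ hγ τ := by simp only [Pi.inv_apply, hf.invariant γ hγ]
  meromorphic_cusps γ := meromorphicAt_cusp_congr (hf.meromorphic_cusps γ).inv
    fun q hq ↦ by simp [expansionAtCusp_apply N _ γ hq]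

/-- The modular functions on `Γ₀(N)`, two of them being identified if they agree outside a closed
discrete set; an algebra over `ℂ`, and a field by `fieldModularFunctionField`. -/
def modularFunctionField (N : ℕ) : Subalgebra ℂ FunModDiscrete where
  carrier := {x | ∃ f : ℍ → ℂ, IsModularFunction N f ∧ (f : FunModDiscrete) = x}
  mul_mem' := by
    rintro _ _ ⟨f, hf, rfl⟩ ⟨g, hg, rfl⟩
    exact ⟨f * g, hf.mul hg, rfl⟩
  add_mem' := by
    rintro _ _ ⟨f, hf, rfl⟩ ⟨g, hg, rfl⟩
    exact ⟨f + g, hf.add hg, rfl⟩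
  algebraMap_mem' c := by
    refine ⟨fun _ ↦ c, isModularFunction_const N c, ?_⟩
    rw [Algebra.algebraMap_eq_smul_one]
    exact congrArg (fun u : ℍ → ℂ ↦ (u : FunModDiscrete)) (by ext; simp)

/-- A modular function as an element of the field of modular functions. -/
def IsModularFunction.toField {N : ℕ} {f : ℍ → ℂ} (hf : IsModularFunction N f) :
    modularFunctionField N :=
  ⟨(f : FunModDiscrete), f, hf, rfl⟩

theorem eventually_codiscrete_iff {p : ℍ → Prop} :
    (∀ᶠ τ in codiscrete ℍ, p τ) ↔
      ∀ τ : ℍ, ∀ᶠ z in 𝓝[≠] (τ : ℂ), p (ofComplex z) := by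
  have key (τ : ℍ) : (∀ᶠ z in 𝓝[≠] (τ : ℂ), p (ofComplex z)) ↔ ∀ᶠ σ in 𝓝[≠] τ, p σ := by
    simp only [eventually_nhdsWithin_iff, ← isOpenEmbedding_coe.map_nhds_eq τ, eventually_map,
      Set.mem_compl_iff, Set.mem_singleton_iff, UpperHalfPlane.ext_iff, ofComplex_apply]
  simp only [key]
  simp only [Filter.Eventually, codiscrete, mem_codiscreteWithin_iff_forall_mem_nhdsNE,
    Set.mem_univ, Set.compl_univ, Set.union_empty, forall_const]

/-- A meromorphic function on `ℍ` that does not vanish identically is nonzero outside a closed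
discrete set. -/
theorem eventually_ne_zero {f : ℍ → ℂ}
    (hf : MeromorphicOn (f ∘ ofComplex) {z : ℂ | 0 < z.im})
    (h0 : ¬ ∀ᶠ τ in codiscrete ℍ, f τ = 0) : ∀ᶠ τ in codiscrete ℍ, f τ ≠ 0 := by
  rw [eventually_codiscrete_iff] at h0 ⊢
  obtain ⟨σ, hσ⟩ := not_forall.1 h0
  have hσ' : meromorphicOrderAt (f ∘ ofComplex) (σ : ℂ) ≠ ⊤ := fun h ↦
    hσ (meromorphicOrderAt_eq_top_iff.1 h)
  intro τ
  have := hf.meromorphicOrderAt_ne_top_of_isPreconnected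
    (convex_halfSpace_im_gt 0).isPreconnected σ.im_pos τ.im_pos hσ'
  exact (meromorphicOrderAt_ne_top_iff_eventually_ne_zero (hf τ τ.im_pos)).1 this

instance neBot_codiscrete : (codiscrete ℍ).NeBot := by
  refine ⟨fun hbot ↦ ?_⟩
  have h : ∀ᶠ _ : ℍ in codiscrete ℍ, False := by simp [hbot]
  have := (eventually_codiscrete_iff (p := fun _ ↦ False)).1 h UpperHalfPlane.I
  simp only [eventually_false_iff_eq_bot] at this
  exact (NormedField.nhdsNE_neBot _).ne this

instance fieldModularFunctionField (N : ℕ) : Field (modularFunctionField N) where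
  inv x := ⟨(x : FunModDiscrete)⁻¹, by
    obtain ⟨_, f, hf, rfl⟩ := x
    exact ⟨f⁻¹, hf.inv, rfl⟩⟩
  mul_inv_cancel := by
    rintro ⟨_, f, hf, rfl⟩ hne
    apply Subtype.ext
    refine Germ.coe_eq.2 ?_
    have h0 : ¬ ∀ᶠ τ in codiscrete ℍ, f τ = 0 := fun h ↦
      hne (Subtype.ext (Germ.coe_eq.2 h))
    filter_upwards [eventually_ne_zero hf.meromorphic h0] with τ hτ
    exact mul_inv_cancel₀ hτ
  inv_zero := by
    apply Subtype.ext
    exact congrArg (fun u : ℍ → ℂ ↦ (u : FunModDiscrete)) (by ext; simp : (0 : ℍ → ℂ)⁻¹ = 0)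
  nnqsmul := _
  nnqsmul_def _ _ := rfl
  qsmul := _
  qsmul_def _ _ := rfl

end OrderSix

end

/-! Put x = q^(1/4). The three-term recurrence of the continuants is solved in closed form: with
base -x^6, the products (-t/x)_m (t x^7)_m, divided by (-x^6)^m, are solutions for t = 1 and t = -1
(`contProd_recurrence`). The numerators are their half sum and the denominators a multiple of their
difference. In the limit the two products are, up to a common factor, one Jacobi theta series at z =
-1/x and z = 1/x, so sum and difference isolate its even and odd parts in z. Each part is again a
theta product, with base (-x^6)^4 = q^6 (`poch_dissection`), and their ratio is the product
expansion of X. The Jacobi triple product is obtained from its finite form by dominated convergence.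

Sorting factors by residue modulo 6 turns X(τ) into η(τ) η(6τ)² / (η(2τ)² η(3τ)); in X(τ) X(3τ) the
factors η(3τ) and η(6τ) cancel.

Modularity is read off from theta functions with characteristics instead of from η. At 6τ, X is the
quotient of those with characteristics (1/6, 0) and (1/3, 0). The group SL(2, ℤ) acts on
characteristics with an automorphy factor that does not depend on them (`exists_siegel_smul`), so it
cancels in the quotient. Hence w ∘ γ is explicit for every γ: invariance under Γ₀(18) reduces to
quasi-periodicity in the characteristic, and the order at a cusp to the exponent ({α}² - {α})/2 of a
theta function (`hasLeading_siegelQuot_mul_smul`).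

Generation rests on w having a single simple pole, at the cusp 1/2. Modulo Γ₀(18) a modular function
f has finitely many poles on ℍ, and a polynomial in w clears them
(`IsModularFunction.exists_clear_poles`); another clears the poles at the cusps other than 1/2
(`exists_polynomial_mul_eq`). Subtracting multiples of powers of w then lowers the pole at 1/2 until
the function is bounded at all cusps, hence constant (`exists_polynomial_eq`). So f = P(w)/D(w). -/

noncomputable section

namespace OrderSix

/-! ### Infinite `q`-Pochhammer symbols and the Jacobi triple product -/

/-- The infinite `q`-Pochhammer symbol `(z; q)_∞`. -/
def poch (z q : ℂ) : ℂ := ∏' i : ℕ, (1 - z * q ^ i)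

theorem summable_norm_mul_pow (z : ℂ) {q : ℂ} (hq : ‖q‖ < 1) :
    Summable fun i : ℕ ↦ ‖-(z * q ^ i)‖ := by
  simp only [norm_neg, norm_mul, norm_pow]
  exact (summable_geometric_of_lt_one (norm_nonneg q) hq).mul_left ‖z‖

theorem multipliable_poch (z : ℂ) {q : ℂ} (hq : ‖q‖ < 1) :
    Multipliable fun i : ℕ ↦ 1 - z * q ^ i := by
  simpa only [sub_eq_add_neg] using multipliable_one_add_of_summable (summable_norm_mul_pow z hq)

theorem tendsto_poch (z : ℂ) {q : ℂ} (hq : ‖q‖ < 1) :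
    Tendsto (fun m : ℕ ↦ ∏ i ∈ Finset.range m, (1 - z * q ^ i)) atTop (𝓝 (poch z q)) :=
  (multipliable_poch z hq).tendsto_prod_tprod_nat

theorem poch_ne_zero {z q : ℂ} (hq : ‖q‖ < 1) (h : ∀ i : ℕ, z * q ^ i ≠ 1) : poch z q ≠ 0 := by
  have := tprod_one_add_ne_zero_of_summable (f := fun i : ℕ ↦ -(z * q ^ i))
    (fun i ↦ by simpa only [← sub_eq_add_neg, sub_ne_zero] using (h i).symm)
    (summable_norm_mul_pow z hq)
  simpa only [← sub_eq_add_neg, poch] using this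

theorem poch_ne_zero_of_norm_lt {z q : ℂ} (hq : ‖q‖ < 1) (hz : ‖z‖ < 1) : poch z q ≠ 0 := by
  refine poch_ne_zero hq fun i h ↦ ?_
  have h1 : ‖z * q ^ i‖ < 1 := by
    rw [norm_mul, norm_pow]
    exact mul_lt_one_of_nonneg_of_lt_one_left (norm_nonneg _) hz
      (pow_le_one₀ (norm_nonneg _) hq.le)
  simp [h] at h1

/-- The finite `q`-Pochhammer symbol `(q; q)_k`. -/
def finPoch (q : ℂ) (k : ℕ) : ℂ := ∏ i ∈ Finset.range k, (1 - q * q ^ i)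

/-- The inverse of `(q; q)_k`, extended by zero to negative `k`. -/
def finPochInv (q : ℂ) : ℤ → ℂ
  | Int.ofNat k => (finPoch q k)⁻¹
  | Int.negSucc _ => 0

section

variable {q : ℂ}

theorem one_sub_pow_succ_ne_zero (hq : ‖q‖ < 1) (i : ℕ) : 1 - q * q ^ i ≠ 0 := by
  intro h
  have h1 : ‖q * q ^ i‖ < 1 := by
    rw [← pow_succ', norm_pow]
    exact pow_lt_one₀ (norm_nonneg _) hq (Nat.succ_ne_zero _)
  rw [← sub_eq_zero.1 h] at h1
  simp at h1

theorem finPoch_ne_zero (hq : ‖q‖ < 1) (k : ℕ) : finPoch q k ≠ 0 :=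
  Finset.prod_ne_zero_iff.2 fun i _ ↦ one_sub_pow_succ_ne_zero hq i

theorem tendsto_finPoch (hq : ‖q‖ < 1) : Tendsto (finPoch q) atTop (𝓝 (poch q q)) :=
  tendsto_poch q hq

theorem poch_self_ne_zero (hq : ‖q‖ < 1) : poch q q ≠ 0 :=
  poch_ne_zero_of_norm_lt hq hq

/-- The factor 1 - q^k vanishes at k = 0, which is what makes the extension by zero consistent: the
recurrence holds for all integers without exception. -/
theorem finPochInv_sub_one (hq : ‖q‖ < 1) (k : ℤ) :
    finPochInv q (k - 1) = (1 - q ^ k) * finPochInv q k := by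
  match k with
  | Int.ofNat 0 =>
    rw [show Int.ofNat 0 - 1 = Int.negSucc 0 from rfl]
    simp [finPochInv]
  | Int.ofNat (k + 1) =>
    have h : Int.ofNat (k + 1) - 1 = Int.ofNat k := by simp
    have h1 := one_sub_pow_succ_ne_zero hq k
    have h2 := finPoch_ne_zero hq k
    rw [h]
    simp only [finPochInv, finPoch, Finset.prod_range_succ]
    simp only [finPoch] at h2
    have h3 : q ^ (Int.ofNat (k + 1)) = q * q ^ k := by
      rw [Int.ofNat_eq_natCast, zpow_natCast, pow_succ']
    rw [h3]
    field_simp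
  | Int.negSucc k =>
    have h : Int.negSucc k - 1 = Int.negSucc (k + 1) := by omega
    rw [h]
    simp [finPochInv]

theorem tendsto_finPochInv (hq : ‖q‖ < 1) (n : ℤ) :
    Tendsto (fun m : ℕ ↦ finPochInv q (m + n)) atTop (𝓝 (poch q q)⁻¹) := by
  have h1 : Tendsto (fun m : ℕ ↦ ((m : ℤ) + n).toNat) atTop atTop := by
    refine tendsto_atTop.2 fun b ↦ ?_
    filter_upwards [eventually_ge_atTop (b + n.natAbs)] with m hm
    omega
  refine (((tendsto_finPoch hq).inv₀ (poch_self_ne_zero hq)).comp h1).congr' ?_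
  filter_upwards [eventually_ge_atTop n.natAbs] with m hm
  obtain ⟨k, hk⟩ := Int.eq_ofNat_of_zero_le (show (0 : ℤ) ≤ m + n by omega)
  simp only [Function.comp_apply, hk, Int.toNat_natCast]
  rfl

theorem exists_norm_finPochInv_le (hq : ‖q‖ < 1) : ∃ C, 0 ≤ C ∧ ∀ n, ‖finPochInv q n‖ ≤ C := by
  obtain ⟨C, hC⟩ := (((tendsto_finPoch hq).inv₀ (poch_self_ne_zero hq)).norm).bddAbove_range
  have h (k : ℕ) : ‖(finPoch q k)⁻¹‖ ≤ C := hC ⟨k, rfl⟩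
  refine ⟨C, (norm_nonneg _).trans (h 0), fun n ↦ ?_⟩
  match n with
  | Int.ofNat k => exact h k
  | Int.negSucc k => simpa [finPochInv] using (norm_nonneg _).trans (h 0)

/-- The coefficient `(q; q)_{2m} / ((q; q)_{m+n} (q; q)_{m-n})`: a central `q`-binomial
coefficient. -/
def qBinom (q : ℂ) (m : ℕ) (n : ℤ) : ℂ :=
  finPoch q (2 * m) * (finPochInv q (m + n) * finPochInv q (m - n))

/-- A twofold q-Pascal rule. By `finPochInv_sub_one` every term is a multiple of the product of
`finPochInv` at m + 1 + n and m + 1 - n, which leaves a polynomial identity; the extension by zero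
covers the boundary values of n. -/
theorem qBinom_succ (hq : ‖q‖ < 1) (hq0 : q ≠ 0) (m : ℕ) (n : ℤ) :
    qBinom q (m + 1) n = (1 + q ^ (2 * m + 1)) * qBinom q m n +
      q ^ ((m : ℤ) + 1 - n) * qBinom q m (n - 1) + q ^ ((m : ℤ) + 1 + n) * qBinom q m (n + 1) := by
  have hu := finPochInv_sub_one hq (m + 1 + n)
  have hu' := finPochInv_sub_one hq (m + n)
  have hv := finPochInv_sub_one hq (m + 1 - n)
  have hv' := finPochInv_sub_one hq (m - n)
  have e1 : (m : ℤ) + 1 + n - 1 = m + n := by ring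
  have e2 : (m : ℤ) + 1 - n - 1 = m - n := by ring
  rw [e1] at hu
  rw [e2] at hv
  have hab : q ^ (2 * m + 1) * q = q ^ ((m : ℤ) + 1 + n) * q ^ ((m : ℤ) + 1 - n) := by
    rw [← zpow_add₀ hq0, ← pow_succ, ← zpow_natCast]
    congr 1
    push_cast
    ring
  have ha : q ^ ((m : ℤ) + n) * q = q ^ ((m : ℤ) + 1 + n) := by
    rw [← zpow_add_one₀ hq0]; congr 1; ring
  have hb : q ^ ((m : ℤ) - n) * q = q ^ ((m : ℤ) + 1 - n) := by
    rw [← zpow_add_one₀ hq0]; congr 1; ring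
  have hP : finPoch q (2 * (m + 1)) =
      finPoch q (2 * m) * (1 - q ^ (2 * m + 1)) * (1 - q ^ (2 * m + 1) * q) := by
    rw [show 2 * (m + 1) = 2 * m + 1 + 1 by ring]
    simp only [finPoch, Finset.prod_range_succ]
    ring
  simp only [qBinom, hP]
  push_cast
  rw [show (m : ℤ) + (n - 1) = m + n - 1 by ring, show (m : ℤ) - (n - 1) = m + 1 - n by ring,
    show (m : ℤ) + (n + 1) = m + 1 + n by ring, show (m : ℤ) - (n + 1) = m - n - 1 by ring,
    hu', hv', hu, hv, ← ha, ← hb]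
  rw [← ha, ← hb] at hab
  have hc : q ^ (2 * m + 1) = q ^ ((m : ℤ) + n) * q ^ ((m : ℤ) - n) * q :=
    mul_right_cancel₀ hq0 (by rw [hab]; ring)
  rw [hc]
  ring

theorem qBinom_zero_of_ne {n : ℤ} (hn : n ≠ 0) : qBinom q 0 n = 0 := by
  match n with
  | Int.ofNat 0 => exact absurd rfl hn
  | Int.ofNat (k + 1) =>
    simp [qBinom, finPochInv, show -((k : ℤ) + 1) = Int.negSucc k by omega]
  | Int.negSucc k => simp [qBinom, finPochInv]

theorem tendsto_qBinom (hq : ‖q‖ < 1) (n : ℤ) :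
    Tendsto (fun m ↦ qBinom q m n) atTop (𝓝 (poch q q)⁻¹) := by
  have h1 : Tendsto (fun m : ℕ ↦ finPoch q (2 * m)) atTop (𝓝 (poch q q)) :=
    (tendsto_finPoch hq).comp (tendsto_id.const_mul_atTop' two_pos)
  have h2 := h1.mul ((tendsto_finPochInv hq n).mul (tendsto_finPochInv hq (-n)))
  rwa [mul_inv_cancel_left₀ (poch_self_ne_zero hq)] at h2

theorem exists_norm_qBinom_le (hq : ‖q‖ < 1) : ∃ C, ∀ m n, ‖qBinom q m n‖ ≤ C := by
  obtain ⟨C, hC0, hC⟩ := exists_norm_finPochInv_le hq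
  obtain ⟨D, hD⟩ := ((tendsto_finPoch hq).norm).bddAbove_range
  have hD' (k : ℕ) : ‖finPoch q k‖ ≤ D := hD ⟨k, rfl⟩
  refine ⟨D * (C * C), fun m n ↦ ?_⟩
  rw [qBinom, norm_mul, norm_mul]
  have := hD' 0
  gcongr
  · exact (norm_nonneg _).trans this
  · exact hD' _
  · exact hC _
  · exact hC _

/-- The finite form of the Jacobi triple product identity. -/
theorem hasSum_mul_qBinom (hq : ‖q‖ < 1) (hq0 : q ≠ 0) {z : ℂ} (hz : z ≠ 0) {e : ℤ → ℂ}
    (he0 : e 0 = 1) (he : ∀ n, e (n + 1) = -z * q ^ n * e n) (m : ℕ) :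
    HasSum (fun n ↦ e n * qBinom q m n)
      ((∏ i ∈ Finset.range m, (1 - z * q ^ i)) * ∏ i ∈ Finset.range m, (1 - q / z * q ^ i)) := by
  induction m with
  | zero =>
    have := hasSum_single (f := fun n ↦ e n * qBinom q 0 n) 0
      fun n hn ↦ by rw [qBinom_zero_of_ne hn, mul_zero]
    simpa [he0, qBinom, finPoch, finPochInv] using this
  | succ m ih =>
    -- The new factor (1 - z q^m)(1 - q^(m+1)/z) expands to 1 + q^(2m+1) - z q^m - q^(m+1)/z; the
    -- last two terms are matched with shifts of n by one.
    have h1 := ih.mul_left (1 + q ^ (2 * m + 1))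
    have h2 := (((Equiv.subRight (1 : ℤ)).hasSum_iff).2 ih).mul_left (-(z * q ^ m))
    have h3 := (((Equiv.addRight (1 : ℤ)).hasSum_iff).2 ih).mul_left (-(q ^ (m + 1) / z))
    have h4 := (h1.add h2).add h3
    rw [Finset.prod_range_succ, Finset.prod_range_succ]
    convert! h4 using 1
    · ext n
      simp only [Function.comp_apply, Equiv.subRight_apply, Equiv.coe_addRight]
      have e1 := he (n - 1)
      rw [sub_add_cancel, zpow_sub_one₀ hq0] at e1
      rw [qBinom_succ hq hq0, he n, zpow_add₀ hq0, zpow_sub₀ hq0, zpow_add_one₀ hq0,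
        zpow_natCast]
      have e2 : z * e (n - 1) = -(q / q ^ n) * e n := by
        rw [e1]
        field_simp
      rw [show -(z * q ^ m) * (e (n - 1) * qBinom q m (n - 1)) =
        -(q ^ m) * (z * e (n - 1)) * qBinom q m (n - 1) by ring, e2]
      field_simp
      ring
    · field_simp
      ring

/-- The Jacobi triple product identity. The terms `(-1) ^ n z ^ n q ^ (n (n - 1) / 2)` of the theta
series are characterised by their recurrence. -/
theorem hasSum_jacobi_triple (hq : ‖q‖ < 1) (hq0 : q ≠ 0) {z : ℂ} (hz : z ≠ 0) {e : ℤ → ℂ}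
    (he0 : e 0 = 1) (he : ∀ n, e (n + 1) = -z * q ^ n * e n) (hs : Summable e) :
    HasSum e (poch q q * (poch z q * poch (q / z) q)) := by
  obtain ⟨C, hC⟩ := exists_norm_qBinom_le hq
  -- The q-binomials are uniformly bounded and tend to 1/(q; q)_∞ termwise, so the limit passes
  -- under the sum.
  have h1 : Tendsto (fun m ↦ ∑' n, e n * qBinom q m n) atTop
      (𝓝 (∑' n, e n * (poch q q)⁻¹)) := by
    refine tendsto_tsum_of_dominated_convergence (bound := fun n ↦ ‖e n‖ * C)
      (hs.norm.mul_right C) (fun n ↦ (tendsto_qBinom hq n).const_mul (e n))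
      (Eventually.of_forall fun m n ↦ ?_)
    rw [norm_mul]
    gcongr
    exact hC m n
  have h2 := (tendsto_poch z hq).mul (tendsto_poch (q / z) hq)
  have h3 := tendsto_nhds_unique
    (h1.congr fun m ↦ (hasSum_mul_qBinom hq hq0 hz he0 he m).tsum_eq) h2
  rw [tsum_mul_right, ← div_eq_mul_inv, div_eq_iff (poch_self_ne_zero hq)] at h3
  rw [mul_comm (poch q q), ← h3]
  exact hs.hasSum

end

/-- The terms of the theta series in the form needed for the Jacobi triple product. -/
theorem jacobiTheta₂_term_succ (n : ℤ) (z τ : ℂ) :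
    jacobiTheta₂_term (n + 1) (z + 1 / 2 - τ / 2) τ =
      -Complex.exp (2 * Real.pi * Complex.I * z) * Complex.exp (2 * Real.pi * Complex.I * τ) ^ n *
        jacobiTheta₂_term n (z + 1 / 2 - τ / 2) τ := by
  simp only [jacobiTheta₂_term]
  rw [← Complex.exp_int_mul, neg_mul, neg_mul, ← neg_one_mul, ← Complex.exp_pi_mul_I,
    ← Complex.exp_add, ← Complex.exp_add, ← Complex.exp_add]
  congr 1
  push_cast
  ring

theorem exists_exp_eq {q : ℂ} (hq : q ≠ 0) : ∃ τ, Complex.exp (2 * Real.pi * Complex.I * τ) = q :=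
  ⟨Complex.log q / (2 * Real.pi * Complex.I), by
    rw [mul_div_cancel₀ _ Complex.two_pi_I_ne_zero, Complex.exp_log hq]⟩

theorem norm_exp_two_pi_I (τ : ℂ) :
    ‖Complex.exp (2 * Real.pi * Complex.I * τ)‖ = Real.exp (-2 * Real.pi * τ.im) := by
  rw [Complex.norm_exp]
  congr 1
  simp

theorem norm_exp_two_pi_I_lt_one_iff {τ : ℂ} :
    ‖Complex.exp (2 * Real.pi * Complex.I * τ)‖ < 1 ↔ 0 < τ.im := by
  rw [norm_exp_two_pi_I, Real.exp_lt_one_iff, neg_mul, neg_mul, neg_lt_zero]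
  exact mul_pos_iff_of_pos_left Real.two_pi_pos

/-- Logarithms τ of q and u of z realise the terms as those of a two-variable Jacobi theta function,
whose summability is known for Im τ > 0. -/
theorem exists_theta_terms {q z : ℂ} (hq : ‖q‖ < 1) (hq0 : q ≠ 0) (hz : z ≠ 0) :
    ∃ e : ℤ → ℂ, e 0 = 1 ∧ (∀ n, e (n + 1) = -z * q ^ n * e n) ∧ Summable e := by
  obtain ⟨τ, rfl⟩ := exists_exp_eq hq0
  obtain ⟨u, rfl⟩ := exists_exp_eq hz
  refine ⟨fun n ↦ jacobiTheta₂_term n (u + 1 / 2 - τ / 2) τ, ?_,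
    fun n ↦ jacobiTheta₂_term_succ n u τ,
    (summable_jacobiTheta₂_term_iff _ _).2 (norm_exp_two_pi_I_lt_one_iff.1 hq)⟩
  simp [jacobiTheta₂_term]

theorem hasSum_int_even_add_odd {f : ℤ → ℂ} {a b : ℂ} (ha : HasSum (fun n ↦ f (2 * n)) a)
    (hb : HasSum (fun n ↦ f (2 * n + 1)) b) : HasSum f (a + b) := by
  have h1 : Function.Injective fun n : ℤ ↦ 2 * n := fun _ _ h ↦ by simpa using h
  have h2 : Function.Injective fun n : ℤ ↦ 2 * n + 1 := fun _ _ h ↦ by simpa using h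
  refine HasSum.add_isCompl (s := Set.range fun n : ℤ ↦ 2 * n)
    (t := Set.range fun n : ℤ ↦ 2 * n + 1) ?_ (h1.hasSum_range_iff.2 ha) (h2.hasSum_range_iff.2 hb)
  convert! Int.isCompl_even_odd using 1
  · ext n; simp [even_iff_exists_two_mul]
  · ext n; simp [Odd]

/-- The dissection of a theta product into its even and odd parts. -/
theorem poch_dissection {q z : ℂ} (hq : ‖q‖ < 1) (hq0 : q ≠ 0) (hz : z ≠ 0) :
    poch q q * (poch z q * poch (q / z) q) =
      poch (q ^ 4) (q ^ 4) * (poch (-z ^ 2 * q) (q ^ 4) * poch (-q ^ 3 / z ^ 2) (q ^ 4)) -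
      z * (poch (q ^ 4) (q ^ 4) * (poch (-z ^ 2 * q ^ 3) (q ^ 4) * poch (-q / z ^ 2) (q ^ 4))) := by
  obtain ⟨e, he0, he, hs⟩ := exists_theta_terms hq hq0 hz
  have hq4 : ‖q ^ 4‖ < 1 := by
    rw [norm_pow]
    exact pow_lt_one₀ (norm_nonneg _) hq (by norm_num)
  -- At 2n the multiplier is z² q (q⁴)^n and at 2n + 1 it is z² q³ (q⁴)^n, so each half of the
  -- series is itself a theta series with base q⁴.
  have hrec (n : ℤ) : e (n + 2) = z ^ 2 * q ^ (2 * n + 1) * e n := by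
    rw [show n + 2 = n + 1 + 1 by ring, he, he, zpow_add_one₀ hq0, two_mul, zpow_add_one₀ hq0,
      zpow_add₀ hq0]
    ring
  have h4 (n : ℤ) : (q ^ 4) ^ n = q ^ (4 * n) := by
    rw [zpow_mul]
    norm_cast
  have h1 : HasSum (fun n ↦ e (2 * n)) _ := hasSum_jacobi_triple hq4 (pow_ne_zero 4 hq0)
    (z := -z ^ 2 * q) (mul_ne_zero (neg_ne_zero.2 (pow_ne_zero 2 hz)) hq0) he0
    (fun n ↦ by
      rw [mul_add, mul_one, hrec, h4, zpow_add_one₀ hq0, ← mul_assoc 2 2 n,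
        show (2 : ℤ) * 2 = 4 by norm_num]
      ring)
    (hs.comp_injective fun _ _ h ↦ by simpa using h)
  -- Since e 1 = -z, the factor -z⁻¹ normalises the initial term to 1.
  have h2 : HasSum (fun n ↦ -z⁻¹ * e (2 * n + 1)) _ := hasSum_jacobi_triple hq4
    (pow_ne_zero 4 hq0)
    (z := -z ^ 2 * q ^ 3) (mul_ne_zero (neg_ne_zero.2 (pow_ne_zero 2 hz)) (pow_ne_zero 3 hq0))
    (by
      have := he 0
      simp only [zero_add, zpow_zero, he0] at this
      simp [this, hz])
    (fun n ↦ by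
      rw [show 2 * (n + 1) + 1 = 2 * n + 1 + 2 by ring, hrec, h4,
        show 2 * (2 * n + 1) + 1 = 4 * n + 3 by ring, zpow_add₀ hq0]
      norm_cast
      ring)
    ((hs.comp_injective (i := fun n : ℤ ↦ 2 * n + 1) fun _ _ h ↦ by simpa using h).mul_left _)
  have h3 := hasSum_int_even_add_odd h1 (f := e) (by
    convert! h2.mul_left (-z) using 2 with n
    field_simp)
  have h5 := (hasSum_jacobi_triple hq hq0 hz he0 he hs).unique h3
  rw [h5, sub_eq_add_neg]
  congr 1
  · congr 3
    field_simp
  · rw [neg_mul, show q ^ 4 / (-z ^ 2 * q ^ 3) = -q / z ^ 2 by field_simp]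

/-! ### Closed form and limit of the continuants -/

section

variable {x : ℂ}

/-- A partial product solving the three-term recurrence of the continuants; the two signs `t = ±1`
give a basis of solutions. -/
def contProd (t x : ℂ) (m : ℕ) : ℂ :=
  (∏ i ∈ Finset.range m, (1 - t * (-x⁻¹) * (-x ^ 6) ^ i)) *
    ∏ i ∈ Finset.range m, (1 - t * x ^ 7 * (-x ^ 6) ^ i)

/-- With r = (-x^6)^m one has x^(12m) = r², so after cancelling the common products only a rational
identity in x, r and t = ±1 remains. -/
theorem contProd_recurrence (hx : x ≠ 0) {t : ℂ} (ht : t ^ 2 = 1) (m : ℕ) :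
    contProd t x (m + 2) * (-x ^ 6)⁻¹ ^ (m + 2) =
      (1 - (x ^ 6)⁻¹) * (1 + x ^ (12 * (m + 1))) *
          (contProd t x (m + 1) * (-x ^ 6)⁻¹ ^ (m + 1)) +
      (x - x ^ (12 * m) * x⁻¹) * ((x ^ 7)⁻¹ - x ^ (12 * m + 7)) *
        (contProd t x m * (-x ^ 6)⁻¹ ^ m) := by
  simp only [contProd, Finset.prod_range_succ, mul_add, pow_add, pow_mul, mul_one]
  generalize (∏ i ∈ Finset.range m, (1 - t * (-x⁻¹) * (-x ^ 6) ^ i)) = A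
  generalize (∏ i ∈ Finset.range m, (1 - t * x ^ 7 * (-x ^ 6) ^ i)) = B
  have h1 : (x ^ 12) ^ m = ((-x ^ 6) ^ m) ^ 2 := by
    rw [← pow_mul (-x ^ 6), mul_comm m 2, pow_mul (-x ^ 6)]
    ring
  rw [h1, inv_pow]
  have h2 : (-x ^ 6) ^ m ≠ 0 := pow_ne_zero _ (neg_ne_zero.2 (pow_ne_zero 6 hx))
  generalize (-x ^ 6) ^ m = r at *
  rcases sq_eq_sq_iff_eq_or_eq_neg.1 (ht.trans (one_pow 2).symm) with rfl | rfl <;>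
    field_simp <;> ring

theorem tendsto_contProd (hx1 : ‖x‖ < 1) (t : ℂ) :
    Tendsto (contProd t x) atTop (𝓝 (poch (t * (-x⁻¹)) (-x ^ 6) * poch (t * x ^ 7) (-x ^ 6))) := by
  have h : ‖-x ^ 6‖ < 1 := by
    rw [norm_neg, norm_pow]
    exact pow_lt_one₀ (norm_nonneg _) hx1 (by norm_num)
  exact (tendsto_poch _ h).mul (tendsto_poch _ h)

/-- The ratio of the limits of the two kinds of continuants. -/
theorem tendsto_contProd_ratio (hx : x ≠ 0) (hx1 : ‖x‖ < 1) :
    Tendsto (fun m ↦ (contProd 1 x m + contProd (-1) x m) / (contProd 1 x m - contProd (-1) x m))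
      atTop (𝓝 (x * (poch (x ^ 4) (x ^ 24) * poch (x ^ 20) (x ^ 24)) /
        (poch (x ^ 16) (x ^ 24) * poch (x ^ 8) (x ^ 24)))) := by
  have hlt (k : ℕ) (hk : k ≠ 0) : ‖x ^ k‖ < 1 := by
    rw [norm_pow]
    exact pow_lt_one₀ (norm_nonneg _) hx1 hk
  have hr : ‖-x ^ 6‖ < 1 := by rw [norm_neg]; exact hlt 6 (by norm_num)
  have hr0 : -x ^ 6 ≠ 0 := neg_ne_zero.2 (pow_ne_zero 6 hx)
  have h1 := tendsto_contProd hx1 1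
  have h2 := tendsto_contProd hx1 (-1)
  -- Passing from z = -1/x to z = 1/x changes neither theta product on the right, only the sign in
  -- front of the odd one. Sum and difference therefore separate them.
  have d1 := poch_dissection hr hr0 (z := 1 * -x⁻¹) (by simpa using hx)
  have d2 := poch_dissection hr hr0 (z := -1 * -x⁻¹) (by simpa using hx)
  rw [show -x ^ 6 / (1 * -x⁻¹) = 1 * x ^ 7 by field_simp,
    show -(1 * -x⁻¹) ^ 2 * -x ^ 6 = x ^ 4 by field_simp,
    show -(-x ^ 6) ^ 3 / (1 * -x⁻¹) ^ 2 = x ^ 20 by field_simp,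
    show -(1 * -x⁻¹) ^ 2 * (-x ^ 6) ^ 3 = x ^ 16 by field_simp,
    show -(-x ^ 6) / (1 * -x⁻¹) ^ 2 = x ^ 8 by field_simp,
    show (-x ^ 6) ^ 4 = x ^ 24 by ring] at d1
  rw [show -x ^ 6 / (-1 * -x⁻¹) = -1 * x ^ 7 by field_simp,
    show -(-1 * -x⁻¹) ^ 2 * -x ^ 6 = x ^ 4 by field_simp,
    show -(-x ^ 6) ^ 3 / (-1 * -x⁻¹) ^ 2 = x ^ 20 by field_simp,
    show -(-1 * -x⁻¹) ^ 2 * (-x ^ 6) ^ 3 = x ^ 16 by field_simp,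
    show -(-x ^ 6) / (-1 * -x⁻¹) ^ 2 = x ^ 8 by field_simp,
    show (-x ^ 6) ^ 4 = x ^ 24 by ring] at d2
  have h0 := poch_self_ne_zero hr
  have hne (k : ℕ) (hk : k ≠ 0) : poch (x ^ k) (x ^ 24) ≠ 0 :=
    poch_ne_zero_of_norm_lt (hlt 24 (by norm_num)) (hlt k hk)
  have n24 := hne 24 (by norm_num)
  have n16 := hne 16 (by norm_num)
  have n8 := hne 8 (by norm_num)
  generalize poch (-x ^ 6) (-x ^ 6) = R at *
  generalize poch (x ^ 24) (x ^ 24) = U at *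
  generalize poch (x ^ 4) (x ^ 24) * poch (x ^ 20) (x ^ 24) = E at *
  generalize hO : poch (x ^ 16) (x ^ 24) * poch (x ^ 8) (x ^ 24) = O at *
  have hO0 : O ≠ 0 := hO ▸ mul_ne_zero n16 n8
  generalize poch (1 * -x⁻¹) (-x ^ 6) * poch (1 * x ^ 7) (-x ^ 6) = Pp at *
  generalize poch (-1 * -x⁻¹) (-x ^ 6) * poch (-1 * x ^ 7) (-x ^ 6) = Pm at *
  have hdiff : Pp - Pm = 2 * U * O / (x * R) := by
    rw [eq_div_iff (mul_ne_zero hx h0),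
      show (Pp - Pm) * (x * R) = x * (R * Pp) - x * (R * Pm) by ring, d1, d2]
    field_simp
    ring
  have hsum : Pp + Pm = 2 * U * E / R := by
    rw [eq_div_iff h0, show (Pp + Pm) * R = R * Pp + R * Pm by ring, d1, d2]
    ring
  convert! (h1.add h2).div (h1.sub h2) (by
    rw [hdiff]
    exact div_ne_zero (mul_ne_zero (mul_ne_zero two_ne_zero n24) hO0) (mul_ne_zero hx h0)) using 2
  rw [hdiff, hsum]
  field_simp

end

/-! ### The value of the continued fraction -/

theorem qPow_ne_zero (z : ℂ) (r : ℚ) : qPow z r ≠ 0 := Complex.exp_ne_zero _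

theorem qPow_eq_zpow (z : ℂ) {r s : ℚ} (n : ℤ) (h : r = n * s) : qPow z r = qPow z s ^ n := by
  rw [qPow, qPow, ← Complex.exp_int_mul, h]
  congr 1
  push_cast
  ring

theorem qPow_eq_pow (z : ℂ) {r s : ℚ} (n : ℕ) (h : r = n * s) : qPow z r = qPow z s ^ n := by
  rw [qPow_eq_zpow z n (by exact_mod_cast h), zpow_natCast]

theorem norm_qPow_lt_one {z : ℂ} (hz : 0 < z.im) {r : ℚ} (hr : 0 < r) : ‖qPow z r‖ < 1 := by
  rw [qPow, mul_assoc, norm_exp_two_pi_I_lt_one_iff]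
  have : (0 : ℝ) < r := by exact_mod_cast hr
  simpa using mul_pos this hz

/-- Both sides satisfy the same recurrence, with initial pairs (1, 0) and (h, 1). The constant 2
(x⁻¹ - x^7) is the difference of the two products at m = 1; it is kept on the left because it may
vanish for general z. -/
theorem contsAux_contFrac (z : ℂ) (m : ℕ) :
    ((contFrac z).contsAux m).a = (contProd 1 (qPow z (1 / 4)) m +
        contProd (-1) (qPow z (1 / 4)) m) / 2 * (-qPow z (1 / 4) ^ 6)⁻¹ ^ m ∧
    ((contFrac z).contsAux m).b * (2 * ((qPow z (1 / 4))⁻¹ - qPow z (1 / 4) ^ 7)) =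
      (contProd 1 (qPow z (1 / 4)) m - contProd (-1) (qPow z (1 / 4)) m) *
        (-qPow z (1 / 4) ^ 6)⁻¹ ^ m * (-qPow z (1 / 4) ^ 6) := by
  have hx := qPow_ne_zero z (1 / 4)
  induction m using Nat.twoStepInduction with
  | zero => simp [contProd]
  | one =>
    have h : qPow z (-3 / 2) = (qPow z (1 / 4) ^ 6)⁻¹ := by
      rw [qPow_eq_zpow z (-6) (s := 1 / 4) (by norm_num), zpow_neg]
      rfl
    simp only [GenContFract.first_contAux_eq_h_one, contProd, Finset.prod_range_one, contFrac, h]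
    constructor <;> field_simp <;> ring
  | more m ih0 ih1 =>
    have hs : (contFrac z).s.get? m = some
      { a := (qPow z (1 / 4) - qPow z (3 * m - 1 / 4)) *
          (qPow z (-7 / 4) - qPow z (3 * m + 7 / 4))
        b := (1 - qPow z (-3 / 2)) * (1 + qPow z (3 * (m + 1))) } := rfl
    rw [GenContFract.contsAux_recurrence hs rfl rfl]
    have h : qPow z (-3 / 2) = (qPow z (1 / 4) ^ 6)⁻¹ := by
      rw [qPow_eq_zpow z (-6) (s := 1 / 4) (by norm_num), zpow_neg]
      rfl
    have h1 : qPow z (3 * (m + 1)) = qPow z (1 / 4) ^ (12 * (m + 1)) :=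
      qPow_eq_pow z _ (by push_cast; ring)
    have h2 : qPow z (3 * m - 1 / 4) = qPow z (1 / 4) ^ (12 * m) * (qPow z (1 / 4))⁻¹ := by
      rw [qPow_eq_zpow z (12 * m - 1 : ℤ) (s := 1 / 4) (by push_cast; ring), zpow_sub_one₀ hx]
      norm_cast
    have h3 : qPow z (-7 / 4) = (qPow z (1 / 4) ^ 7)⁻¹ := by
      rw [qPow_eq_zpow z (-7) (s := 1 / 4) (by norm_num), zpow_neg]
      rfl
    have h4 : qPow z (3 * m + 7 / 4) = qPow z (1 / 4) ^ (12 * m + 7) :=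
      qPow_eq_pow z _ (by push_cast; ring)
    have r1 := contProd_recurrence hx (t := 1) (by norm_num) m
    have r2 := contProd_recurrence hx (t := -1) (by norm_num) m
    obtain ⟨ia0, ib0⟩ := ih0
    obtain ⟨ia1, ib1⟩ := ih1
    simp only [h, h1, h2, h3, h4]
    generalize qPow z (1 / 4) = x at *
    generalize (-x ^ 6)⁻¹ ^ (m + 2) = t2 at *
    generalize (-x ^ 6)⁻¹ ^ (m + 1) = t1 at *
    generalize (-x ^ 6)⁻¹ ^ m = t0 at *
    constructor
    · rw [ia0, ia1]
      linear_combination (-1 / 2) * r1 - (1 / 2) * r2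
    · rw [add_mul, mul_assoc _ _ (2 * (x⁻¹ - x ^ 7)), ib1, mul_assoc _ _ (2 * (x⁻¹ - x ^ 7)), ib0]
      linear_combination x ^ 6 * r1 - x ^ 6 * r2

/-- The product expansion of `X`. -/
def prodX (z : ℂ) : ℂ :=
  qPow z (1 / 4) * (poch (qPow z 5) (qPow z 6) * poch (qPow z 1) (qPow z 6) /
    (poch (qPow z 4) (qPow z 6) * poch (qPow z 2) (qPow z 6)))

theorem tendsto_approxX {z : ℂ} (hz : 0 < z.im) :
    Tendsto (approxX z) atTop (𝓝 (prodX z)) := by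
  have hx := qPow_ne_zero z (1 / 4)
  have hx1 : ‖qPow z (1 / 4)‖ < 1 := norm_qPow_lt_one hz (by norm_num)
  have e1 : qPow z (7 / 4) = qPow z (1 / 4) ^ 7 := qPow_eq_pow z 7 (by norm_num)
  have e2 : qPow z 2 = qPow z (1 / 4) ^ 8 := qPow_eq_pow z 8 (by norm_num)
  have e3 : qPow z 1 = qPow z (1 / 4) ^ 4 := qPow_eq_pow z 4 (by norm_num)
  have e4 : qPow z 4 = qPow z (1 / 4) ^ 16 := qPow_eq_pow z 16 (by norm_num)
  have e5 : qPow z 5 = qPow z (1 / 4) ^ 20 := qPow_eq_pow z 20 (by norm_num)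
  have e6 : qPow z 6 = qPow z (1 / 4) ^ 24 := qPow_eq_pow z 24 (by norm_num)
  have h8 : qPow z (1 / 4) ^ 8 - 1 ≠ 0 := by
    intro h
    have := pow_lt_one₀ (norm_nonneg _) hx1 (show 8 ≠ 0 by norm_num)
    rw [← norm_pow, sub_eq_zero.1 h] at this
    simp at this
  -- The n-th convergent uses the auxiliary continuants of index n + 1.
  have key := ((tendsto_contProd_ratio hx hx1).comp (tendsto_add_atTop_nat 1))
  rw [prodX, e2, e3, e4, e5, e6]
  rw [mul_comm (poch (_ ^ 20) _), ← mul_div_assoc]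
  refine key.congr fun n ↦ ?_
  obtain ⟨ha, hb⟩ := contsAux_contFrac z (n + 1)
  rw [approxX, GenContFract.conv_eq_conts_a_div_conts_b,
    GenContFract.nth_cont_eq_succ_nth_contAux, ha, e1, e2, Function.comp_apply]
  generalize qPow z (1 / 4) = x at *
  have h8' : 1 - x ^ 8 ≠ 0 := fun h ↦ h8 (by linear_combination -h)
  have hy : x⁻¹ - x ^ 7 = (1 - x ^ 8) / x := by field_simp
  have ht : (-x ^ 6)⁻¹ ^ (n + 1) ≠ 0 :=
    pow_ne_zero _ (inv_ne_zero (neg_ne_zero.2 (pow_ne_zero 6 hx)))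
  generalize (-x ^ 6)⁻¹ ^ (n + 1) = t at *
  rw [hy] at hb
  rw [← eq_div_iff (mul_ne_zero two_ne_zero (div_ne_zero h8' hx))] at hb
  rw [hb]
  -- If a denominator vanishes, both sides are 0 by the convention for division by zero, so the
  -- equality of the two sequences holds for every n.
  by_cases hD : contProd 1 x (n + 1) - contProd (-1) x (n + 1) = 0
  · simp [hD]
  · field_simp
    ring

theorem X_eq_prodX {z : ℂ} (hz : 0 < z.im) : X z = prodX z :=
  (tendsto_approxX hz).limUnder_eq

theorem qPow_add (z : ℂ) (r s : ℚ) : qPow z (r + s) = qPow z r * qPow z s := by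
  rw [qPow, qPow, qPow, ← Complex.exp_add]
  congr 1
  push_cast
  ring

theorem hasProd_factorX {z : ℂ} (hz : 0 < z.im) :
    HasProd (fun n : ℕ ↦ factorX z (n + 1))
      (poch (qPow z 5) (qPow z 6) * poch (qPow z 1) (qPow z 6) /
        (poch (qPow z 4) (qPow z 6) * poch (qPow z 2) (qPow z 6))) := by
  have h6 : ‖qPow z 6‖ < 1 := norm_qPow_lt_one hz (by norm_num)
  have hp (r : ℚ) :
      HasProd (fun n : ℕ ↦ 1 - qPow z r * qPow z 6 ^ n) (poch (qPow z r) (qPow z 6)) :=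
    (multipliable_poch _ h6).hasProd
  have hne (r : ℚ) (hr : 0 < r) : poch (qPow z r) (qPow z 6) ≠ 0 :=
    poch_ne_zero_of_norm_lt h6 (norm_qPow_lt_one hz hr)
  have := ((hp 5).mul (hp 1)).div₀ ((hp 4).mul (hp 2))
    (mul_ne_zero (hne 4 (by norm_num)) (hne 2 (by norm_num)))
  convert! this using 2 with n
  have h (r : ℚ) : qPow z (6 * ((n + 1 : ℕ) : ℚ) - r) = qPow z (6 - r) * qPow z 6 ^ n := by
    rw [← qPow_eq_pow z n (r := n * 6) rfl, ← qPow_add]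
    congr 1
    push_cast
    ring
  simp only [factorX, h]
  norm_num

theorem prodX_eq_tprod {z : ℂ} (hz : 0 < z.im) :
    prodX z = qPow z (1 / 4) * ∏' n : ℕ, factorX z (n + 1) := by
  rw [(hasProd_factorX hz).tprod_eq, prodX]

/-- The factors are sorted by the residue of their index modulo k. -/
theorem poch_eq_prod_poch (z : ℂ) {q : ℂ} (hq : ‖q‖ < 1) {k : ℕ} (hk : k ≠ 0) :
    poch z q = ∏ j ∈ Finset.range k, poch (z * q ^ j) (q ^ k) := by
  have hqk : ‖q ^ k‖ < 1 := by
    rw [norm_pow]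
    exact pow_lt_one₀ (norm_nonneg _) hq hk
  have h1 : Tendsto (fun m : ℕ ↦ ∏ i ∈ Finset.range (k * m), (1 - z * q ^ i)) atTop
      (𝓝 (poch z q)) :=
    (tendsto_poch z hq).comp (tendsto_id.const_mul_atTop' (Nat.pos_of_ne_zero hk))
  have h2 := tendsto_finsetProd (Finset.range k) fun j _ ↦ tendsto_poch (z * q ^ j) hqk
  refine tendsto_nhds_unique h1 (h2.congr fun m ↦ ?_)
  rw [Finset.prod_comm]
  induction m with
  | zero => simp
  | succ m ih =>
    rw [Finset.prod_range_succ, ih, mul_add, mul_one, Finset.prod_range_add]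
    congr 1
    refine Finset.prod_congr rfl fun j _ ↦ ?_
    rw [← pow_mul, mul_assoc, ← pow_add, add_comm]

theorem eta_eq_poch (z : ℂ) (k : ℕ) :
    ModularForm.eta (k * z) = qPow z (k / 24) * poch (qPow z k) (qPow z k) := by
  have h : Function.Periodic.qParam 1 (k * z) = qPow z k := by
    rw [Function.Periodic.qParam, qPow]
    congr 1
    push_cast
    ring
  rw [ModularForm.eta, poch]
  congr 1
  · rw [Function.Periodic.qParam, qPow]
    congr 1
    push_cast
    ring
  · simp only [ModularForm.eta_q, h, pow_succ']

/-- Up to powers of q this is X = η(τ) η(6τ)² / (η(2τ)² η(3τ)): the residues prime to 6 arise by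
inclusion and exclusion of the multiples of 2 and 3. -/
theorem prodX_eq_poch {z : ℂ} (hz : 0 < z.im) :
    prodX z = qPow z (1 / 4) * (poch (qPow z 1) (qPow z 1) * poch (qPow z 6) (qPow z 6) ^ 2 /
      (poch (qPow z 2) (qPow z 2) ^ 2 * poch (qPow z 3) (qPow z 3))) := by
  have hlt (r : ℚ) (hr : 0 < r) := norm_qPow_lt_one hz hr
  have h6 := hlt 6 (by norm_num)
  have e1 := poch_eq_prod_poch (qPow z 1) (hlt 1 (by norm_num)) (k := 6) (by norm_num)
  have e2 := poch_eq_prod_poch (qPow z 2) (hlt 2 (by norm_num)) (k := 3) (by norm_num)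
  have e3 := poch_eq_prod_poch (qPow z 3) (hlt 3 (by norm_num)) (k := 2) (by norm_num)
  have hp (a b c : ℚ) (k : ℕ) (h : a + k * b = c) : qPow z a * qPow z b ^ k = qPow z c := by
    rw [← qPow_eq_pow z k rfl, ← qPow_add, h]
  simp only [Finset.prod_range_succ, Finset.prod_range_zero, one_mul,
    ← qPow_eq_pow z 6 (show (6 : ℚ) = (6 : ℕ) * 1 by norm_num), pow_zero, mul_one,
    hp 1 1 2 1 (by norm_num), hp 1 1 3 2 (by norm_num), hp 1 1 4 3 (by norm_num),
    hp 1 1 5 4 (by norm_num), hp 1 1 6 5 (by norm_num)] at e1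
  simp only [Finset.prod_range_succ, Finset.prod_range_zero, one_mul,
    ← qPow_eq_pow z 3 (show (6 : ℚ) = (3 : ℕ) * 2 by norm_num), pow_zero, mul_one,
    hp 2 2 4 1 (by norm_num), hp 2 2 6 2 (by norm_num)] at e2
  simp only [Finset.prod_range_succ, Finset.prod_range_zero, one_mul,
    ← qPow_eq_pow z 2 (show (6 : ℚ) = (2 : ℕ) * 3 by norm_num), pow_zero, mul_one,
    hp 3 3 6 1 (by norm_num)] at e3
  have hne (r : ℚ) (hr : 0 < r) : poch (qPow z r) (qPow z 6) ≠ 0 :=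
    poch_ne_zero_of_norm_lt h6 (hlt r hr)
  have n2 := hne 2 (by norm_num)
  have n3 := hne 3 (by norm_num)
  have n4 := hne 4 (by norm_num)
  have n6 := hne 6 (by norm_num)
  rw [prodX, e1, e2, e3]
  field_simp

theorem qPow_three_mul (z : ℂ) (r : ℚ) : qPow (3 * z) r = qPow z (3 * r) := by
  rw [qPow, qPow]
  congr 1
  push_cast
  ring

theorem w_eq_prodX (τ : ℍ) : w τ = prodX τ * prodX (3 * τ) := by
  rw [w, X_eq_prodX τ.im_pos, X_eq_prodX (by simpa using τ.im_pos)]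

theorem w_eq_eta (τ : ℍ) : w τ =
    ModularForm.eta τ * ModularForm.eta (18 * τ) ^ 2 /
      (ModularForm.eta (2 * τ) ^ 2 * ModularForm.eta (9 * τ)) := by
  have h3 : 0 < (3 * (τ : ℂ)).im := by simpa using τ.im_pos
  have hne (r : ℚ) (hr : 0 < r) : poch (qPow τ r) (qPow τ r) ≠ 0 :=
    poch_self_ne_zero (norm_qPow_lt_one τ.im_pos hr)
  have e1 := eta_eq_poch τ 1
  have e18 := eta_eq_poch τ 18
  have e2 := eta_eq_poch τ 2
  have e9 := eta_eq_poch τ 9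
  push_cast at e1 e18 e2 e9
  rw [one_mul] at e1
  rw [w_eq_prodX, prodX_eq_poch τ.im_pos, prodX_eq_poch h3, e1, e18, e2, e9]
  simp only [qPow_three_mul]
  norm_num1
  have hx := qPow_ne_zero τ (1 / 24)
  -- In units of q^(1/24), both sides have exponent 6 + 18 = 24 = 1 + 2·18 - 2·2 - 9.
  rw [qPow_eq_pow τ 6 (show (1 / 4 : ℚ) = (6 : ℕ) * (1 / 24) by norm_num),
    qPow_eq_pow τ 18 (show (3 / 4 : ℚ) = (18 : ℕ) * (1 / 24) by norm_num),
    qPow_eq_pow τ 2 (show (1 / 12 : ℚ) = (2 : ℕ) * (1 / 24) by norm_num),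
    qPow_eq_pow τ 9 (show (3 / 8 : ℚ) = (9 : ℕ) * (1 / 24) by norm_num)]
  have n2 := hne 2 (by norm_num)
  have n3 := hne 3 (by norm_num)
  have n6 := hne 6 (by norm_num)
  have n9 := hne 9 (by norm_num)
  field_simp

theorem prodX_ne_zero {z : ℂ} (hz : 0 < z.im) : prodX z ≠ 0 := by
  have hne (r : ℚ) (hr : 0 < r) : poch (qPow z r) (qPow z 6) ≠ 0 :=
    poch_ne_zero_of_norm_lt (norm_qPow_lt_one hz (by norm_num)) (norm_qPow_lt_one hz hr)
  exact mul_ne_zero (qPow_ne_zero _ _) (div_ne_zero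
    (mul_ne_zero (hne 5 (by norm_num)) (hne 1 (by norm_num)))
    (mul_ne_zero (hne 4 (by norm_num)) (hne 2 (by norm_num))))

theorem w_ne_zero (τ : ℍ) : w τ ≠ 0 := by
  rw [w_eq_prodX]
  exact mul_ne_zero (prodX_ne_zero τ.im_pos) (prodX_ne_zero (by simpa using τ.im_pos))

theorem differentiableOn_w : DifferentiableOn ℂ (w ∘ ofComplex) {z : ℂ | 0 < z.im} := by
  have h (k : ℕ) (hk : 0 < k) {z : ℂ} (hz : 0 < z.im) :
      DifferentiableAt ℂ (fun z : ℂ ↦ ModularForm.eta (k * z)) z := by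
    have hkz : (k * z) ∈ upperHalfPlaneSet := by
      have : (0 : ℝ) < k := by exact_mod_cast hk
      simpa [upperHalfPlaneSet] using mul_pos this hz
    exact (ModularForm.differentiableAt_eta_of_mem_upperHalfPlaneSet hkz).comp z
      (differentiableAt_id.const_mul _)
  have hne (k : ℕ) (hk : 0 < k) {z : ℂ} (hz : 0 < z.im) : ModularForm.eta (k * z) ≠ 0 := by
    refine ModularForm.eta_ne_zero ?_
    have : (0 : ℝ) < k := by exact_mod_cast hk
    simpa [upperHalfPlaneSet] using mul_pos this hz
  have h0 : DifferentiableOn ℂ (fun z : ℂ ↦ ModularForm.eta ((1 : ℕ) * z) *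
      ModularForm.eta ((18 : ℕ) * z) ^ 2 /
      (ModularForm.eta ((2 : ℕ) * z) ^ 2 * ModularForm.eta ((9 : ℕ) * z))) {z : ℂ | 0 < z.im} :=
    fun z hz ↦ (((h 1 (by norm_num) hz).mul ((h 18 (by norm_num) hz).pow 2)).div
      (((h 2 (by norm_num) hz).pow 2).mul (h 9 (by norm_num) hz))
      (mul_ne_zero (pow_ne_zero 2 (hne 2 (by norm_num) hz))
        (hne 9 (by norm_num) hz))).differentiableWithinAt
  refine h0.congr fun z hz ↦ ?_
  rw [Function.comp_apply, w_eq_eta, ofComplex_apply_of_im_pos hz]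
  simp

/-! ### Theta functions with characteristics -/

/-- The theta function with characteristic `(α, β)`, a multiple of the Siegel function
`g_(α, β)` by a power of `η` that does not depend on `(α, β)`. -/
def siegel (α β τ : ℂ) : ℂ :=
  Complex.exp (Real.pi * Complex.I * (α * (α * τ + β) - (α * τ + β) + τ / 4)) *
    jacobiTheta₂ (α * τ + β + 1 / 2 - τ / 2) τ

theorem jacobiTheta₂_eq_poch (z : ℂ) {τ : ℂ} (hτ : 0 < τ.im) :
    jacobiTheta₂ (z + 1 / 2 - τ / 2) τ =
      poch (Complex.exp (2 * Real.pi * Complex.I * τ)) (Complex.exp (2 * Real.pi * Complex.I * τ)) *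
      (poch (Complex.exp (2 * Real.pi * Complex.I * z))
          (Complex.exp (2 * Real.pi * Complex.I * τ)) *
        poch (Complex.exp (2 * Real.pi * Complex.I * (τ - z)))
          (Complex.exp (2 * Real.pi * Complex.I * τ))) := by
  have h := hasSum_jacobi_triple (norm_exp_two_pi_I_lt_one_iff.2 hτ) (Complex.exp_ne_zero _)
    (z := Complex.exp (2 * Real.pi * Complex.I * z)) (Complex.exp_ne_zero _)
    (e := fun n ↦ jacobiTheta₂_term n (z + 1 / 2 - τ / 2) τ) (by simp [jacobiTheta₂_term])
    (fun n ↦ jacobiTheta₂_term_succ n z τ) ((summable_jacobiTheta₂_term_iff _ _).2 hτ)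
  rw [jacobiTheta₂, h.tsum_eq, ← Complex.exp_sub, mul_sub]

theorem siegel_eq_poch (α β : ℂ) {τ : ℂ} (hτ : 0 < τ.im) :
    siegel α β τ =
      Complex.exp (Real.pi * Complex.I * (α * (α * τ + β) - (α * τ + β) + τ / 4)) *
      (poch (Complex.exp (2 * Real.pi * Complex.I * τ)) (Complex.exp (2 * Real.pi * Complex.I * τ)) *
      (poch (Complex.exp (2 * Real.pi * Complex.I * (α * τ + β)))
          (Complex.exp (2 * Real.pi * Complex.I * τ)) *
        poch (Complex.exp (2 * Real.pi * Complex.I * (τ - (α * τ + β))))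
          (Complex.exp (2 * Real.pi * Complex.I * τ)))) := by
  rw [siegel, jacobiTheta₂_eq_poch _ hτ]

theorem exp_two_pi_I_add_one (z : ℂ) :
    Complex.exp (2 * Real.pi * Complex.I * (z + 1)) = Complex.exp (2 * Real.pi * Complex.I * z) := by
  rw [mul_add, mul_one, Complex.exp_add, Complex.exp_two_pi_mul_I, mul_one]

theorem siegel_add_one (α β : ℂ) {τ : ℂ} (hτ : 0 < τ.im) :
    siegel α β (τ + 1) = Complex.exp (Real.pi * Complex.I / 4) * siegel α (α + β) τ := by
  rw [siegel_eq_poch α β (by simpa using hτ), siegel_eq_poch α _ hτ, exp_two_pi_I_add_one,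
    show α * (τ + 1) + β = α * τ + (α + β) by ring,
    show τ + 1 - (α * τ + (α + β)) = τ - (α * τ + (α + β)) + 1 by ring, exp_two_pi_I_add_one,
    ← mul_assoc (Complex.exp (Real.pi * Complex.I / 4)), ← Complex.exp_add]
  congr 2
  ring

/-- This is Jacobi's functional equation. The exponential prefactor of `siegel` absorbs everything
that depends on the characteristic. -/
theorem siegel_neg_inv (α β : ℂ) {τ : ℂ} (hτ : 0 < τ.im) :
    siegel α β (-τ⁻¹) = Complex.exp (-(Real.pi * Complex.I / 2)) *
      (-Complex.I * τ) ^ (1 / 2 : ℂ) * siegel β (-α) τ := by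
  have hτ0 : τ ≠ 0 := by rintro rfl; simp at hτ
  have hs : (-Complex.I * τ) ^ (1 / 2 : ℂ) ≠ 0 := by
    rw [Ne, Complex.cpow_eq_zero_iff]
    simp [hτ0]
  -- The inversion turns the half period -τ/2 into +τ/2, whence the shift by a full period τ.
  have h := jacobiTheta₂_functional_equation (β * τ + -α + 1 / 2 - τ / 2 + τ) τ
  rw [jacobiTheta₂_add_left',
    show (β * τ + -α + 1 / 2 - τ / 2 + τ) / τ = α * -τ⁻¹ + β + 1 / 2 - -τ⁻¹ / 2 by field_simp; ring,
    show -1 / τ = -τ⁻¹ by field_simp] at h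
  rw [siegel, siegel]
  generalize jacobiTheta₂ (α * -τ⁻¹ + β + 1 / 2 - -τ⁻¹ / 2) (-τ⁻¹) = A at *
  generalize jacobiTheta₂ (β * τ + -α + 1 / 2 - τ / 2) τ = B at *
  have hA : A = (-Complex.I * τ) ^ (1 / 2 : ℂ) *
      (Complex.exp (Real.pi * Complex.I * (β * τ + -α + 1 / 2 - τ / 2 + τ) ^ 2 / τ) *
      (Complex.exp (-Real.pi * Complex.I * (τ + 2 * (β * τ + -α + 1 / 2 - τ / 2))) * B)) := by
    rw [h]
    rw [show Real.pi * Complex.I * (β * τ + -α + 1 / 2 - τ / 2 + τ) ^ 2 / τ =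
      -(-Real.pi * Complex.I * (β * τ + -α + 1 / 2 - τ / 2 + τ) ^ 2 / τ) by ring, Complex.exp_neg]
    field_simp [Complex.exp_ne_zero]
  rw [hA]
  rw [mul_left_comm, mul_right_comm (Complex.exp (-(Real.pi * Complex.I / 2))),
    mul_comm ((-Complex.I * τ) ^ (1 / 2 : ℂ))]
  congr 1
  rw [← mul_assoc, ← mul_assoc, ← mul_assoc, ← Complex.exp_add, ← Complex.exp_add,
    ← Complex.exp_add]
  congr 2
  field_simp
  ring

theorem siegel_add_one_right (α β : ℂ) (τ : ℂ) :
    siegel α (β + 1) τ = -Complex.exp (Real.pi * Complex.I * α) * siegel α β τ := by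
  rw [siegel, siegel, show α * τ + (β + 1) + 1 / 2 - τ / 2 = α * τ + β + 1 / 2 - τ / 2 + 1 by ring,
    jacobiTheta₂_add_left, ← mul_assoc]
  congr 1
  rw [← neg_one_mul, ← Complex.exp_pi_mul_I, ← Complex.exp_add, ← Complex.exp_add,
    Complex.exp_eq_exp_iff_exists_int]
  exact ⟨-1, by push_cast; ring⟩

theorem siegel_add_one_left (α β : ℂ) (τ : ℂ) :
    siegel (α + 1) β τ = -Complex.exp (-(Real.pi * Complex.I * β)) * siegel α β τ := by
  rw [siegel, siegel, show (α + 1) * τ + β + 1 / 2 - τ / 2 = α * τ + β + 1 / 2 - τ / 2 + τ by ring,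
    jacobiTheta₂_add_left', ← mul_assoc, ← mul_assoc]
  congr 1
  rw [← neg_one_mul (Complex.exp _), ← Complex.exp_pi_mul_I, ← Complex.exp_add, ← Complex.exp_add,
    ← Complex.exp_add, Complex.exp_eq_exp_iff_exists_int]
  exact ⟨-1, by push_cast; ring⟩

theorem siegel_neg (α β : ℂ) (τ : ℂ) : siegel (-α) (-β) τ = -siegel α β τ := by
  rw [siegel, siegel, ← jacobiTheta₂_neg_left,
    show -(-α * τ + -β + 1 / 2 - τ / 2) = α * τ + β + 1 / 2 - τ / 2 + τ - 1 by ring,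
    ← jacobiTheta₂_add_left, sub_add_cancel, jacobiTheta₂_add_left', ← mul_assoc, ← neg_mul]
  congr 1
  rw [← neg_one_mul (Complex.exp _), ← Complex.exp_pi_mul_I, ← Complex.exp_add, ← Complex.exp_add,
    Complex.exp_eq_exp_iff_exists_int]
  exact ⟨-1, by push_cast; ring⟩

/-- The transformation law under `SL(2, ℤ)`, with a factor that does not depend on the
characteristic. -/
theorem exists_siegel_smul (γ : SL(2, ℤ)) (τ : ℍ) : ∃ J : ℂ, J ≠ 0 ∧ ∀ α β : ℂ,
    siegel α β (γ • τ : ℍ) = J * siegel (α * γ 0 0 + β * γ 1 0) (α * γ 0 1 + β * γ 1 1) τ := by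
  have hγ : γ ∈ Subgroup.closure {ModularGroup.S, ModularGroup.T} := by
    simp [SpecialLinearGroup.SL2Z_generators]
  induction hγ using Subgroup.closure_induction generalizing τ with
  | mem γ h =>
    rcases h with rfl | rfl
    · refine ⟨Complex.exp (-(Real.pi * Complex.I / 2)) * (-Complex.I * τ) ^ (1 / 2 : ℂ),
        mul_ne_zero (Complex.exp_ne_zero _) ?_, fun α β ↦ ?_⟩
      · rw [Ne, Complex.cpow_eq_zero_iff]
        simp [τ.ne_zero]
      · have h := siegel_neg_inv α β τ.im_pos
        rw [modular_S_smul, coe_mk, inv_neg, h]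
        simp [ModularGroup.S]
    · refine ⟨_, Complex.exp_ne_zero (Real.pi * Complex.I / 4), fun α β ↦ ?_⟩
      have := siegel_add_one α β τ.im_pos
      rw [modular_T_smul]
      simpa [ModularGroup.T, add_comm] using this
  | one => exact ⟨1, one_ne_zero, fun α β ↦ by simp⟩
  | mul γ δ _ _ ih1 ih2 =>
    obtain ⟨J, hJ, h⟩ := ih1 (δ • τ)
    obtain ⟨K, hK, h'⟩ := ih2 τ
    refine ⟨J * K, mul_ne_zero hJ hK, fun α β ↦ ?_⟩
    rw [mul_smul, h, h', ← mul_assoc]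
    simp only [Matrix.SpecialLinearGroup.coe_mul, Matrix.mul_apply, Fin.sum_univ_two]
    push_cast
    congr 2 <;> ring
  | inv γ _ ih =>
    obtain ⟨J, hJ, h⟩ := ih (γ⁻¹ • τ)
    refine ⟨J⁻¹, inv_ne_zero hJ, fun α β ↦ ?_⟩
    have hdet : (γ 0 0 : ℂ) * γ 1 1 - γ 0 1 * γ 1 0 = 1 := by
      have := γ.det_coe
      rw [Matrix.det_fin_two] at this
      exact_mod_cast this
    -- The law for γ at the characteristic (α, β) γ⁻¹ is the law for γ⁻¹ at (α, β).
    have := h (α * γ 1 1 - β * γ 1 0) (-α * γ 0 1 + β * γ 0 0)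
    rw [smul_inv_smul, show (α * γ 1 1 - β * γ 1 0) * γ 0 0 + (-α * γ 0 1 + β * γ 0 0) * γ 1 0 =
      α * (γ 0 0 * γ 1 1 - γ 0 1 * γ 1 0) by ring,
      show (α * γ 1 1 - β * γ 1 0) * γ 0 1 + (-α * γ 0 1 + β * γ 0 0) * γ 1 1 =
      β * (γ 0 0 * γ 1 1 - γ 0 1 * γ 1 0) by ring, hdet, mul_one, mul_one] at this
    rw [eq_inv_mul_iff_mul_eq₀ hJ, ← this, Matrix.SpecialLinearGroup.SL2_inv_expl]
    simp [sub_eq_add_neg]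

/-! ### `X` as a quotient of theta functions -/

/-- The quotient of the theta functions with characteristics `(α, β)` and `(2α, 2β)`. -/
def siegelQuot (α β τ : ℂ) : ℂ := siegel α β τ / siegel (2 * α) (2 * β) τ

theorem siegelQuot_smul (γ : SL(2, ℤ)) (τ : ℍ) (α β : ℂ) :
    siegelQuot α β (γ • τ : ℍ) =
      siegelQuot (α * γ 0 0 + β * γ 1 0) (α * γ 0 1 + β * γ 1 1) τ := by
  obtain ⟨J, hJ, h⟩ := exists_siegel_smul γ τ
  rw [siegelQuot, siegelQuot, h, h, mul_div_mul_left _ _ hJ]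
  congr 2 <;> ring

theorem siegelQuot_neg (α β τ : ℂ) : siegelQuot (-α) (-β) τ = siegelQuot α β τ := by
  rw [siegelQuot, siegelQuot, mul_neg, mul_neg, siegel_neg, siegel_neg, neg_div_neg_eq]

theorem siegelQuot_add_one_right (α β τ : ℂ) :
    siegelQuot α (β + 1) τ =
      -Complex.exp (-(3 * (Real.pi * Complex.I * α))) * siegelQuot α β τ := by
  have h : Complex.exp (-(3 * (Real.pi * Complex.I * α))) = Complex.exp (Real.pi * Complex.I * α) *
      (Complex.exp (Real.pi * Complex.I * (2 * α)) * Complex.exp (Real.pi * Complex.I * (2 * α)))⁻¹ := by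
    rw [← Complex.exp_add, ← Complex.exp_neg, ← Complex.exp_add]
    congr 1
    ring
  rw [siegelQuot, siegelQuot, show 2 * (β + 1) = 2 * β + 1 + 1 by ring, siegel_add_one_right,
    siegel_add_one_right, siegel_add_one_right, h]
  field_simp [Complex.exp_ne_zero]

theorem siegelQuot_add_one_left (α β τ : ℂ) :
    siegelQuot (α + 1) β τ =
      -Complex.exp (3 * (Real.pi * Complex.I * β)) * siegelQuot α β τ := by
  have h : Complex.exp (3 * (Real.pi * Complex.I * β)) = Complex.exp (-(Real.pi * Complex.I * β)) *
      (Complex.exp (-(Real.pi * Complex.I * (2 * β))) *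
        Complex.exp (-(Real.pi * Complex.I * (2 * β))))⁻¹ := by
    rw [← Complex.exp_add, ← Complex.exp_neg, ← Complex.exp_add]
    congr 1
    ring
  rw [siegelQuot, siegelQuot, show 2 * (α + 1) = 2 * α + 1 + 1 by ring, siegel_add_one_left,
    siegel_add_one_left, siegel_add_one_left, h]
  field_simp [Complex.exp_ne_zero]

/-- Iteration of a quasi-periodicity over the integers. -/
theorem apply_add_int {F : ℂ → ℂ} {c : ℂ} (hc : c ≠ 0) (h : ∀ x, F (x + 1) = c * F x) (x : ℂ)
    (n : ℤ) : F (x + n) = c ^ n * F x := by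
  induction n with
  | zero => simp
  | succ n ih =>
    push_cast at ih ⊢
    rw [← add_assoc, h, ih, zpow_add_one₀ hc]
    ring
  | pred n ih =>
    have := h (x + ((-n - 1 : ℤ) : ℂ))
    rw [show x + ((-n - 1 : ℤ) : ℂ) + 1 = x + (-n : ℤ) by push_cast; ring, ih] at this
    rw [zpow_sub_one₀ hc, mul_right_comm, this]
    field_simp

theorem siegelQuot_add_int_right (α β τ : ℂ) (n : ℤ) :
    siegelQuot α (β + n) τ =
      (-Complex.exp (-(3 * (Real.pi * Complex.I * α)))) ^ n * siegelQuot α β τ :=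
  apply_add_int (F := fun β ↦ siegelQuot α β τ) (neg_ne_zero.2 (Complex.exp_ne_zero _))
    (fun β ↦ siegelQuot_add_one_right α β τ) β n

theorem siegelQuot_add_int_left (α τ : ℂ) (n : ℤ) :
    siegelQuot (α + n) 0 τ = (-1) ^ n * siegelQuot α 0 τ :=
  apply_add_int (F := fun α ↦ siegelQuot α 0 τ) (by norm_num)
    (fun α ↦ by simpa using siegelQuot_add_one_left α 0 τ) α n

/-- At 6z the base is q^6, and the characteristics (1/6, 0) and (1/3, 0) give the theta products at
q and q². Their prefactors differ exactly by q^(1/4). -/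
theorem prodX_eq_siegelQuot {z : ℂ} (hz : 0 < z.im) : prodX z = siegelQuot (1 / 6) 0 (6 * z) := by
  have h6z : 0 < (6 * z).im := by simpa using hz
  have hlt (r : ℚ) (hr : 0 < r) := norm_qPow_lt_one hz hr
  rw [siegelQuot, siegel_eq_poch _ _ h6z, siegel_eq_poch _ _ h6z, prodX]
  have e (r : ℚ) (s : ℂ) (h : s = r * z) :
      Complex.exp (2 * Real.pi * Complex.I * s) = qPow z r := by
    rw [qPow, h, mul_assoc _ (r : ℂ)]
  rw [e 6 (6 * z) (by norm_num), e 1 (1 / 6 * (6 * z) + 0) (by push_cast; ring),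
    e 5 (6 * z - (1 / 6 * (6 * z) + 0)) (by push_cast; ring),
    e 2 (2 * (1 / 6) * (6 * z) + 2 * 0) (by push_cast; ring),
    e 4 (6 * z - (2 * (1 / 6) * (6 * z) + 2 * 0)) (by push_cast; ring)]
  have hexp : qPow z (1 / 4) * Complex.exp (Real.pi * Complex.I * (2 * (1 / 6) *
      (2 * (1 / 6) * (6 * z) + 2 * 0) - (2 * (1 / 6) * (6 * z) + 2 * 0) + 6 * z / 4)) =
      Complex.exp (Real.pi * Complex.I * (1 / 6 * (1 / 6 * (6 * z) + 0) -
        (1 / 6 * (6 * z) + 0) + 6 * z / 4)) := by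
    rw [qPow, ← Complex.exp_add]
    congr 1
    push_cast
    ring
  rw [← hexp]
  have hne (r : ℚ) (hr : 0 < r) : poch (qPow z r) (qPow z 6) ≠ 0 :=
    poch_ne_zero_of_norm_lt (hlt 6 (by norm_num)) (hlt r hr)
  have n2 := hne 2 (by norm_num)
  have n4 := hne 4 (by norm_num)
  have n6 := hne 6 (by norm_num)
  field_simp [Complex.exp_ne_zero]

/-! ### Invariance of `w` under `Γ₀(18)` -/

theorem det_eq_one (γ : SL(2, ℤ)) : γ 0 0 * γ 1 1 - γ 0 1 * γ 1 0 = 1 := by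
  have := γ.det_coe
  rwa [Matrix.det_fin_two] at this

theorem coe_smul_eq (γ : SL(2, ℤ)) (τ : ℍ) :
    ((γ • τ : ℍ) : ℂ) = (γ 0 0 * τ + γ 0 1) / (γ 1 0 * τ + γ 1 1) := by
  simpa using coe_specialLinearGroup_apply γ τ

theorem denom_ne_zero' (γ : SL(2, ℤ)) (τ : ℍ) : (γ 1 0 * τ + γ 1 1 : ℂ) ≠ 0 := by
  simpa [denom] using denom_ne_zero (Matrix.SpecialLinearGroup.mapGL ℝ γ) τ

/-- A criterion for `N (γ τ) = δ σ`. -/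
theorem mul_coe_smul_eq {N : ℂ} {γ δ : SL(2, ℤ)} {τ σ : ℍ}
    (h : N * (γ 0 0 * τ + γ 0 1) * (δ 1 0 * σ + δ 1 1) =
      (δ 0 0 * σ + δ 0 1) * (γ 1 0 * τ + γ 1 1)) :
    N * (γ • τ : ℍ) = ((δ • σ : ℍ) : ℂ) := by
  rw [coe_smul_eq, coe_smul_eq, ← mul_div_assoc,
    div_eq_div_iff (denom_ne_zero' γ τ) (denom_ne_zero' δ σ), h]

theorem w_eq_siegelQuot (τ : ℍ) :
    w τ = siegelQuot (1 / 6) 0 (6 * τ) * siegelQuot (1 / 6) 0 (18 * τ) := by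
  rw [w_eq_prodX, prodX_eq_siegelQuot τ.im_pos, prodX_eq_siegelQuot (by simpa using τ.im_pos),
    ← mul_assoc]
  norm_num

/-- When N divides the lower left entry, conjugation by diag(N, 1) keeps γ integral: N (γ τ) = δ (N
τ) with δ in SL(2, ℤ). -/
theorem siegelQuot_mul_smul {N : ℕ} (hN : 0 < N) {γ : SL(2, ℤ)} (h : (N : ℤ) ∣ γ 1 0) (τ : ℍ) :
    siegelQuot (1 / 6) 0 (N * (γ • τ : ℍ)) =
      siegelQuot (γ 0 0 / 6) (N * γ 0 1 / 6) (N * τ) := by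
  obtain ⟨c, hc⟩ := h
  let δ : SL(2, ℤ) := ⟨!![γ 0 0, N * γ 0 1; c, γ 1 1], by
    rw [Matrix.det_fin_two_of]; linear_combination det_eq_one γ + γ 0 1 * hc⟩
  have hτ : 0 < ((N : ℂ) * τ).im := by
    have : (0 : ℝ) < N := by exact_mod_cast hN
    simpa using mul_pos this τ.im_pos
  have e : (N : ℂ) * (γ • τ : ℍ) = ((δ • (⟨N * τ, hτ⟩ : ℍ) : ℍ) : ℂ) := by
    apply mul_coe_smul_eq
    simp only [δ, hc, Matrix.of_apply, Matrix.cons_val', Matrix.cons_val_zero, Matrix.cons_val_one]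
    push_cast
    ring
  rw [e, siegelQuot_smul]
  simp [δ, div_eq_inv_mul]

/-- Writing a, b for the upper row of γ, the characteristics become (a/6, b) and (a/6, 3b). Integer
shifts reduce b to 0, and a ≡ ±1 mod 6 reduces a/6 to ±1/6, where evenness of the quotient applies.
The multipliers cancel only in the product of the two factors. -/
theorem w_smul {γ : SL(2, ℤ)} (hγ : γ ∈ CongruenceSubgroup.Gamma0 18) (τ : ℍ) :
    w (γ • τ) = w τ := by
  have h18 : (18 : ℤ) ∣ γ 1 0 := by
    rw [CongruenceSubgroup.Gamma0_mem] at hγ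
    exact (ZMod.intCast_zmod_eq_zero_iff_dvd _ 18).1 hγ
  have h1 := siegelQuot_mul_smul (N := 6) (by norm_num) ((by norm_num : (6 : ℤ) ∣ 18).trans h18) τ
  have h2 := siegelQuot_mul_smul (N := 18) (by norm_num) h18 τ
  have hdet := det_eq_one γ
  rw [w_eq_siegelQuot, w_eq_siegelQuot]
  push_cast at h1 h2
  rw [h1, h2]
  have e1 := siegelQuot_add_int_right (γ 0 0 / 6) 0 (6 * τ) (γ 0 1)
  have e2 := siegelQuot_add_int_right (γ 0 0 / 6) 0 (18 * τ) (3 * γ 0 1)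
  push_cast at e1 e2
  rw [zero_add] at e1 e2
  rw [show 6 * (γ 0 1 : ℂ) / 6 = γ 0 1 by ring, show 18 * (γ 0 1 : ℂ) / 6 = 3 * γ 0 1 by ring, e1,
    e2, mul_mul_mul_comm]
  -- In total this is the power 4b of -exp(-π i a / 2), which is exp(-2π i a b) = 1.
  have hu : (-Complex.exp (-(3 * (Real.pi * Complex.I * (γ 0 0 / 6))))) ^ γ 0 1 *
      (-Complex.exp (-(3 * (Real.pi * Complex.I * (γ 0 0 / 6))))) ^ (3 * γ 0 1) = 1 := by
    rw [← zpow_add₀ (neg_ne_zero.2 (Complex.exp_ne_zero _)),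
      show γ 0 1 + 3 * γ 0 1 = 2 * (2 * γ 0 1) by ring, zpow_mul]
    rw [zpow_ofNat, neg_sq, ← Complex.exp_nat_mul, ← Complex.exp_int_mul, Complex.exp_eq_one_iff]
    exact ⟨-(γ 0 0 * γ 0 1), by push_cast; ring⟩
  rw [hu, one_mul]
  -- Each factor contributes the sign (-1)^m.
  have key (m : ℤ) : siegelQuot (1 / 6 + m) 0 (6 * τ) * siegelQuot (1 / 6 + m) 0 (18 * τ) =
      siegelQuot (1 / 6) 0 (6 * τ) * siegelQuot (1 / 6) 0 (18 * τ) := by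
    rw [siegelQuot_add_int_left, siegelQuot_add_int_left, mul_mul_mul_comm, ← mul_zpow]
    norm_num
  have hcop : IsCoprime (γ 0 0) 6 := by
    obtain ⟨c, hc⟩ := h18
    exact ⟨γ 1 1, -(γ 0 1 * c * 3), by rw [hc] at hdet; linear_combination hdet⟩
  have hmod : (γ 0 0) % 6 = 1 ∨ (γ 0 0) % 6 = 5 := by
    have h2 : ¬ (2 : ℤ) ∣ γ 0 0 := fun h ↦ by
      have := hcop.isUnit_of_dvd' h (by norm_num); rw [Int.isUnit_iff] at this; omega
    have h3 : ¬ (3 : ℤ) ∣ γ 0 0 := fun h ↦ by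
      have := hcop.isUnit_of_dvd' h (by norm_num); rw [Int.isUnit_iff] at this; omega
    omega
  rcases hmod with h | h
  · obtain ⟨m, hm⟩ : ∃ m, γ 0 0 = 1 + 6 * m := ⟨γ 0 0 / 6, by omega⟩
    rw [hm, ← key m]
    congr 2 <;> push_cast <;> ring
  · obtain ⟨m, hm⟩ : ∃ m, γ 0 0 = -(1 + 6 * m) := ⟨-γ 0 0 / 6, by omega⟩
    rw [hm, ← key m, ← siegelQuot_neg, ← siegelQuot_neg _ _ (18 * (τ : ℂ)), neg_zero]
    congr 2 <;> push_cast <;> ring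

/-! ### Leading exponents at `i∞` -/

/-- `F τ ~ C exp (2 π i κ τ)` with `C ≠ 0` as `Im τ → ∞`. -/
def HasLeading (F : ℍ → ℂ) (κ : ℝ) : Prop :=
  ∃ C : ℂ, C ≠ 0 ∧ Tendsto (fun τ : ℍ ↦ F τ * Complex.exp (-(2 * Real.pi * Complex.I * κ * τ)))
    atImInfty (𝓝 C)

theorem HasLeading.mul {F G : ℍ → ℂ} {κ μ : ℝ} (hF : HasLeading F κ) (hG : HasLeading G μ) :
    HasLeading (fun τ ↦ F τ * G τ) (κ + μ) := by
  obtain ⟨C, hC, h⟩ := hF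
  obtain ⟨D, hD, h'⟩ := hG
  refine ⟨C * D, mul_ne_zero hC hD, (h.mul h').congr fun τ ↦ ?_⟩
  rw [mul_mul_mul_comm, ← Complex.exp_add]
  congr 2
  push_cast
  ring

theorem HasLeading.div {F G : ℍ → ℂ} {κ μ : ℝ} (hF : HasLeading F κ) (hG : HasLeading G μ) :
    HasLeading (fun τ ↦ F τ / G τ) (κ - μ) := by
  obtain ⟨C, hC, h⟩ := hF
  obtain ⟨D, hD, h'⟩ := hG
  refine ⟨C / D, div_ne_zero hC hD, (h.div h' hD).congr fun τ ↦ ?_⟩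
  simp only [Pi.div_apply]
  rw [mul_div_mul_comm, ← Complex.exp_sub]
  congr 2
  push_cast
  ring

theorem HasLeading.const_mul {F : ℍ → ℂ} {κ : ℝ} (hF : HasLeading F κ) {c : ℂ} (hc : c ≠ 0) :
    HasLeading (fun τ ↦ c * F τ) κ := by
  obtain ⟨C, hC, h⟩ := hF
  exact ⟨c * C, mul_ne_zero hc hC, (h.const_mul c).congr fun τ ↦ (mul_assoc _ _ _).symm⟩

theorem HasLeading.comp_affine {F : ℍ → ℂ} {κ : ℝ} (hF : HasLeading F κ) {s : ℍ → ℍ} {A B : ℝ}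
    (hA : 0 < A) (hs : ∀ τ, (s τ : ℂ) = A * τ + B) : HasLeading (fun τ ↦ F (s τ)) (κ * A) := by
  obtain ⟨C, hC, h⟩ := hF
  have hlim : Tendsto s atImInfty atImInfty := by
    rw [atImInfty, tendsto_comap_iff]
    have : (UpperHalfPlane.im ∘ s) = fun τ ↦ A * τ.im := by
      ext τ
      simpa using congrArg Complex.im (hs τ)
    rw [this]
    exact tendsto_comap.const_mul_atTop hA
  refine ⟨C * Complex.exp (2 * Real.pi * Complex.I * κ * B),
    mul_ne_zero hC (Complex.exp_ne_zero _),
    ((h.comp hlim).mul_const _).congr fun τ ↦ ?_⟩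
  simp only [Function.comp_apply]
  rw [mul_assoc, ← Complex.exp_add, hs]
  congr 2
  push_cast
  ring

theorem tendsto_exp_mul_atImInfty {r : ℝ} (hr : 0 < r) (b : ℂ) :
    Tendsto (fun τ : ℍ ↦ Complex.exp (2 * Real.pi * Complex.I * (r * τ + b))) atImInfty (𝓝 0) := by
  rw [tendsto_zero_iff_norm_tendsto_zero]
  simp only [norm_exp_two_pi_I]
  refine Real.tendsto_exp_atBot.comp ?_
  have h1 : Tendsto (fun τ : ℍ ↦ τ.im) atImInfty atTop := tendsto_comap
  have h2 : Tendsto (fun τ : ℍ ↦ r * τ.im + b.im) atImInfty atTop :=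
    tendsto_atTop_add_const_right _ _ (h1.const_mul_atTop hr)
  refine (h2.const_mul_atTop_of_neg (r := -2 * Real.pi)
    (by linarith [Real.pi_pos])).congr fun τ ↦ ?_
  simp

/-- As q → 0 only the factor of index 0 survives; eventually |q| ≤ 1/2, so a geometric series
dominates. -/
theorem tendsto_poch_of_tendsto_zero {ι : Type*} {l : Filter ι} {a q : ι → ℂ} {a₀ : ℂ}
    (ha : Tendsto a l (𝓝 a₀)) (hq : Tendsto q l (𝓝 0)) :
    Tendsto (fun i ↦ poch (a i) (q i)) l (𝓝 (1 - a₀)) := by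
  have h := tendsto_tprod_one_add_of_dominated_convergence (𝓕 := l)
    (f := fun i (k : ℕ) ↦ -(a i * q i ^ k)) (g := fun k ↦ if k = 0 then -a₀ else 0)
    (bound := fun k ↦ (‖a₀‖ + 1) * (1 / 2) ^ k)
    ((summable_geometric_of_lt_one (by norm_num) (by norm_num)).mul_left _)
    (fun k ↦ by
      split_ifs with hk
      · simpa [hk] using ha.neg
      · simpa [hk] using (ha.mul (hq.pow k)).neg)
    (by
      have h1 := ha.norm.eventually_le_const (lt_add_one ‖a₀‖)
      have h2 := hq.norm.eventually_le_const (show ‖(0 : ℂ)‖ < 1 / 2 by norm_num)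
      filter_upwards [h1, h2] with i hi hi' k
      rw [norm_neg, norm_mul, norm_pow]
      gcongr)
  rw [tprod_eq_mulSingle 0 (fun k hk ↦ by simp [hk])] at h
  simpa [poch, sub_eq_add_neg] using h

/-- The leading exponent of a theta function whose first characteristic lies in `[0, 1)`. -/
theorem hasLeading_siegel_of_lt_one {α β : ℝ} (h0 : 0 ≤ α) (h1 : α < 1)
    (h : α = 0 → ∀ n : ℤ, β ≠ n) :
    HasLeading (fun τ : ℍ ↦ siegel α β τ) ((α ^ 2 - α) / 2 + 1 / 8) := by
  have hq : Tendsto (fun τ : ℍ ↦ Complex.exp (2 * Real.pi * Complex.I * τ)) atImInfty (𝓝 0) := by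
    simpa using tendsto_exp_mul_atImInfty one_pos 0
  have hζ' : Tendsto (fun τ : ℍ ↦ Complex.exp (2 * Real.pi * Complex.I * (τ - (α * τ + β))))
      atImInfty (𝓝 0) := by
    refine (tendsto_exp_mul_atImInfty (sub_pos.2 h1) (-β)).congr fun τ ↦ ?_
    congr 2
    push_cast
    ring
  -- The limit is 0 for α > 0 and exp(2π i β) for α = 0; the hypothesis on β keeps the latter away
  -- from 1, where the leading coefficient would vanish.
  obtain ⟨c, hc, hζ⟩ : ∃ c : ℂ, c ≠ 1 ∧
      Tendsto (fun τ : ℍ ↦ Complex.exp (2 * Real.pi * Complex.I * (α * τ + β))) atImInfty (𝓝 c) := by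
    rcases h0.eq_or_lt' with rfl | hα
    · refine ⟨Complex.exp (2 * Real.pi * Complex.I * β), fun hβ ↦ ?_, by simp⟩
      obtain ⟨n, hn⟩ := Complex.exp_eq_one_iff.1 hβ
      rw [mul_comm] at hn
      have := mul_right_cancel₀ Complex.two_pi_I_ne_zero hn
      exact h rfl n (by exact_mod_cast this)
    · exact ⟨0, zero_ne_one, tendsto_exp_mul_atImInfty hα β⟩
  have hlim := (tendsto_poch_of_tendsto_zero hq hq).mul
    ((tendsto_poch_of_tendsto_zero hζ hq).mul (tendsto_poch_of_tendsto_zero hζ' hq))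
  refine ⟨Complex.exp (Real.pi * Complex.I * (α * β - β)) * (1 - c),
    mul_ne_zero (Complex.exp_ne_zero _) (sub_ne_zero.2 hc.symm), ?_⟩
  simp only [sub_zero, one_mul, mul_one] at hlim
  refine (hlim.const_mul _).congr fun τ ↦ ?_
  beta_reduce
  rw [siegel_eq_poch _ _ τ.im_pos, mul_right_comm (Complex.exp (Real.pi * Complex.I *
    (α * (α * τ + β) - (α * τ + β) + τ / 4))), ← Complex.exp_add]
  congr 2
  push_cast
  ring

theorem hasLeading_siegel {α β : ℝ} (h : ∀ m n : ℤ, ¬ (α = m ∧ β = n)) :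
    HasLeading (fun τ : ℍ ↦ siegel α β τ)
      ((Int.fract α ^ 2 - Int.fract α) / 2 + 1 / 8) := by
  have h1 := hasLeading_siegel_of_lt_one (β := β) (Int.fract_nonneg α) (Int.fract_lt_one α)
    fun h0 n hn ↦ h ⌊α⌋ n ⟨by linarith [Int.floor_add_fract α], hn⟩
  have hc := neg_ne_zero.2 (Complex.exp_ne_zero (-(Real.pi * Complex.I * β)))
  have h2 := h1.const_mul (zpow_ne_zero ⌊α⌋ hc)
  convert! h2 using 2 with τ
  rw [← apply_add_int (F := fun α ↦ siegel α β τ) hc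
    (fun x ↦ siegel_add_one_left x β τ) (Int.fract α : ℝ) ⌊α⌋]
  congr 1
  exact_mod_cast (Int.fract_add_floor α).symm

/-- The leading exponent of the theta quotient with characteristic `(a / 6, b / 6)`. -/
def quotExponent (a : ℤ) : ℝ :=
  if a % 6 = 1 ∨ a % 6 = 5 then 1 / 24 else if a % 6 = 3 then -1 / 8 else 0

/-- The exponent is (y² - y)/2 at y = {a/6} minus its value at y = {a/3}. Coprimality excludes
integral characteristics, where numerator or denominator would vanish identically. -/
theorem hasLeading_siegelQuot {a b : ℤ} (hab : IsCoprime a b) :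
    HasLeading (fun τ : ℍ ↦ siegelQuot (a / 6) (b / 6) τ) (quotExponent a) := by
  have hne (m n : ℤ) (k : ℤ) (hk : 1 < k) (ha : a = k * m) (hb : b = k * n) : False := by
    have := hab.isUnit_of_dvd' ⟨m, ha⟩ ⟨n, hb⟩
    rw [Int.isUnit_iff] at this
    omega
  have h1 := hasLeading_siegel (α := (a : ℝ) / 6) (β := (b : ℝ) / 6) fun m n h ↦ by
    have e1 : (a : ℝ) = 6 * m := by linarith [h.1]
    have e2 : (b : ℝ) = 6 * n := by linarith [h.2]
    exact hne m n 6 (by norm_num) (by exact_mod_cast e1) (by exact_mod_cast e2)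
  have h2 := hasLeading_siegel (α := 2 * ((a : ℝ) / 6)) (β := 2 * ((b : ℝ) / 6)) fun m n h ↦ by
    have e1 : (a : ℝ) = 3 * m := by linarith [h.1]
    have e2 : (b : ℝ) = 3 * n := by linarith [h.2]
    exact hne m n 3 (by norm_num) (by exact_mod_cast e1) (by exact_mod_cast e2)
  have h3 := h1.div h2
  convert! h3 using 1
  · ext τ
    push_cast
    rfl
  · have hf (x : ℝ) (n : ℤ) (y : ℝ) (hx : x = n + y) (h0 : 0 ≤ y) (h1 : y < 1) :
        Int.fract x = y := by
      rw [hx, Int.fract_intCast_add, Int.fract_eq_self.2 ⟨h0, h1⟩]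
    have hdiv : (a : ℝ) = 6 * ((a / 6 : ℤ) : ℝ) + ((a % 6 : ℤ) : ℝ) := by
      exact_mod_cast (Int.mul_ediv_add_emod a 6).symm
    have hmod : a % 6 = 0 ∨ a % 6 = 1 ∨ a % 6 = 2 ∨ a % 6 = 3 ∨ a % 6 = 4 ∨ a % 6 = 5 := by omega
    generalize a / 6 = m at hdiv
    rw [quotExponent]
    rcases hmod with h | h | h | h | h | h <;> rw [h] at hdiv ⊢ <;> push_cast at hdiv
    · rw [hf (a / 6) m 0 (by linarith) (by norm_num) (by norm_num),
        hf (2 * (a / 6)) (2 * m) 0 (by push_cast; linarith) (by norm_num) (by norm_num)]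
      norm_num
    · rw [hf (a / 6) m (1 / 6) (by linarith) (by norm_num) (by norm_num),
        hf (2 * (a / 6)) (2 * m) (1 / 3) (by push_cast; linarith) (by norm_num) (by norm_num)]
      norm_num
    · rw [hf (a / 6) m (1 / 3) (by linarith) (by norm_num) (by norm_num),
        hf (2 * (a / 6)) (2 * m) (2 / 3) (by push_cast; linarith) (by norm_num) (by norm_num)]
      norm_num
    · rw [hf (a / 6) m (1 / 2) (by linarith) (by norm_num) (by norm_num),
        hf (2 * (a / 6)) (2 * m + 1) 0 (by push_cast; linarith) (by norm_num) (by norm_num)]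
      norm_num
    · rw [hf (a / 6) m (2 / 3) (by linarith) (by norm_num) (by norm_num),
        hf (2 * (a / 6)) (2 * m + 1) (1 / 3) (by push_cast; linarith) (by norm_num) (by norm_num)]
      norm_num
    · rw [hf (a / 6) m (5 / 6) (by linarith) (by norm_num) (by norm_num),
        hf (2 * (a / 6)) (2 * m + 1) (2 / 3) (by push_cast; linarith) (by norm_num) (by norm_num)]
      norm_num

/-- The leading exponent of `X (N γ τ / 6)`, in terms of `g = gcd (N, c)` where `c` is the lower
left entry of `γ`. -/
theorem hasLeading_siegelQuot_mul_smul (γ : SL(2, ℤ)) {N g M : ℕ} {c' : ℤ} (hg : 0 < g)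
    (hM : 0 < M) (hN : N = g * M) (hc : γ 1 0 = g * c') (hcop : IsCoprime (M : ℤ) c') :
    HasLeading (fun τ : ℍ ↦ siegelQuot (1 / 6) 0 (N * (γ • τ : ℍ)))
      (quotExponent (M * γ 0 0) * (g / M)) := by
  have hdet := det_eq_one γ
  have hcop' : IsCoprime (M * γ 0 0) c' := by
    refine IsCoprime.mul_left hcop ⟨γ 1 1, -(γ 0 1 * g), ?_⟩
    rw [hc] at hdet
    linear_combination hdet
  obtain ⟨u, v, huv⟩ := hcop'
  -- The matrix diag(N, 1) γ equals δ times an upper triangular matrix with diagonal (g, M); the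
  -- latter acts as the affine map s below.
  let δ : SL(2, ℤ) := ⟨!![M * γ 0 0, -v; c', u], by
    rw [Matrix.det_fin_two_of]; linear_combination huv⟩
  have hg' : (0 : ℝ) < g := by exact_mod_cast hg
  have hM' : (0 : ℝ) < M := by exact_mod_cast hM
  have hMC : (M : ℂ) ≠ 0 := by exact_mod_cast hM.ne'
  let s : ℍ → ℍ := fun τ ↦ ⟨((g / M : ℝ) : ℂ) * τ + (((u * N * γ 0 1 + v * γ 1 1) / M : ℝ) : ℂ), by
    rw [Complex.add_im, Complex.ofReal_im, add_zero, Complex.im_ofReal_mul]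
    exact mul_pos (div_pos hg' hM') τ.im_pos⟩
  have hcoe (τ : ℍ) : (s τ : ℂ) = ((g / M : ℝ) : ℂ) * τ +
    (((u * N * γ 0 1 + v * γ 1 1) / M : ℝ) : ℂ) := rfl
  have hrow : IsCoprime ((M : ℤ) * γ 0 0) (-v) := ⟨u, -c', by linear_combination huv⟩
  have h := (hasLeading_siegelQuot hrow).comp_affine (div_pos hg' hM') hcoe
  convert! h using 2 with τ
  have e : (N : ℂ) * (γ • τ : ℍ) = ((δ • s τ : ℍ) : ℂ) := by
    apply mul_coe_smul_eq
    simp only [δ, hc, hN, Matrix.of_apply, Matrix.cons_val', Matrix.cons_val_zero,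
      Matrix.cons_val_one]
    have hdet' : (γ 0 0 : ℂ) * γ 1 1 - γ 0 1 * (g * c') = 1 := by
      rw [hc] at hdet; exact_mod_cast hdet
    have huv' : (u : ℂ) * (M * γ 0 0) + v * c' = 1 := by exact_mod_cast huv
    have hσ : (M : ℂ) * s τ = g * τ + (u * (g * M) * γ 0 1 + v * γ 1 1) := by
      rw [hcoe, hN]
      push_cast
      field_simp
    push_cast
    linear_combination (-(M * s τ)) * hdet' + g * τ * huv' - hσ
  rw [e, siegelQuot_smul]
  simp [δ, div_eq_inv_mul]

/-! ### Leading exponents of `w` at the cusps -/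

theorem isCoprime_left_col (γ : SL(2, ℤ)) : IsCoprime (γ 0 0) (γ 1 0) :=
  ⟨γ 1 1, -γ 0 1, by linear_combination det_eq_one γ⟩

theorem not_dvd_of_isCoprime {a c p : ℤ} (h : IsCoprime a c) (hp : 1 < p) (hc : p ∣ c) :
    ¬ p ∣ a := fun ha ↦ by
  have := h.isUnit_of_dvd' ha hc
  rw [Int.isUnit_iff] at this
  omega

theorem hasLeading_w_of (γ : SL(2, ℤ)) {g M g' M' : ℕ} {c c' : ℤ} {κ : ℝ} (hg : 0 < g)
    (hM : 0 < M) (hN : 6 = g * M) (hc : γ 1 0 = g * c) (hcop : IsCoprime (M : ℤ) c)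
    (hg' : 0 < g') (hM' : 0 < M') (hN' : 18 = g' * M') (hc' : γ 1 0 = g' * c')
    (hcop' : IsCoprime (M' : ℤ) c')
    (hκ : quotExponent (M * γ 0 0) * (g / M) + quotExponent (M' * γ 0 0) * (g' / M') = κ) :
    HasLeading (fun τ ↦ w (γ • τ)) κ := by
  have h1 := hasLeading_siegelQuot_mul_smul γ hg hM hN hc hcop
  have h2 := hasLeading_siegelQuot_mul_smul γ hg' hM' hN' hc' hcop'
  convert! h1.mul h2 using 1
  · ext τ
    rw [w_eq_siegelQuot]
    norm_num
  · exact hκ.symm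

theorem isCoprime_two {c : ℤ} (h : ¬ (2 : ℤ) ∣ c) : IsCoprime (2 : ℤ) c :=
  Int.prime_two.coprime_iff_not_dvd.2 h

theorem isCoprime_three {c : ℤ} (h : ¬ (3 : ℤ) ∣ c) : IsCoprime (3 : ℤ) c :=
  Int.prime_three.coprime_iff_not_dvd.2 h

/-- The cusps equivalent to `∞`. -/
theorem hasLeading_w_one {γ : SL(2, ℤ)} (h : (18 : ℤ) ∣ γ 1 0) :
    HasLeading (fun τ ↦ w (γ • τ)) 1 := by
  obtain ⟨c, hc⟩ := h
  have h2 := not_dvd_of_isCoprime (isCoprime_left_col γ) (p := 2) (by norm_num) (by omega)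
  have h3 := not_dvd_of_isCoprime (isCoprime_left_col γ) (p := 3) (by norm_num) (by omega)
  refine hasLeading_w_of γ (g := 6) (M := 1) (g' := 18) (M' := 1) (c := 3 * c) (c' := c)
    (by norm_num) (by norm_num) (by norm_num) (by push_cast; omega) (by simp [isCoprime_one_left])
    (by norm_num) (by norm_num) (by norm_num) (by push_cast; omega) (by simp [isCoprime_one_left])
    ?_
  have : quotExponent (γ 0 0) = 1 / 24 := if_pos (by omega)
  -- The two contributions are 6/24 and 18/24.
  norm_num [this]

/-- The cusps equivalent to `1/2`. -/
theorem hasLeading_w_two {γ : SL(2, ℤ)} (h : (2 : ℤ) ∣ γ 1 0) (h' : ¬ (3 : ℤ) ∣ γ 1 0) :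
    HasLeading (fun τ ↦ w (γ • τ)) (-1 / 9) := by
  obtain ⟨c, hc⟩ := h
  have h2 := not_dvd_of_isCoprime (isCoprime_left_col γ) (p := 2) (by norm_num) (by omega)
  have h3 : IsCoprime (3 : ℤ) c := isCoprime_three (by omega)
  refine hasLeading_w_of γ (g := 2) (M := 3) (g' := 2) (M' := 9) (c := c) (c' := c)
    (by norm_num) (by norm_num) (by norm_num) (by push_cast; omega) (by exact_mod_cast h3)
    (by norm_num) (by norm_num) (by norm_num) (by push_cast; omega)
    (by simpa using h3.pow_left (m := 2)) ?_
  -- The sum is -(1/8)(2/3) - (1/8)(2/9) = -1/9, a simple pole because the width is 9.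
  have e1 : quotExponent ((3 : ℕ) * γ 0 0) = -1 / 8 := by
    rw [quotExponent, if_neg (by push_cast; omega), if_pos (by push_cast; omega)]
  have e2 : quotExponent ((9 : ℕ) * γ 0 0) = -1 / 8 := by
    rw [quotExponent, if_neg (by push_cast; omega), if_pos (by push_cast; omega)]
  rw [e1, e2]
  norm_num

/-- The remaining cusps. -/
theorem hasLeading_w_zero {γ : SL(2, ℤ)} (h : ¬ (18 : ℤ) ∣ γ 1 0)
    (h' : ¬ ((2 : ℤ) ∣ γ 1 0 ∧ ¬ (3 : ℤ) ∣ γ 1 0)) : HasLeading (fun τ ↦ w (γ • τ)) 0 := by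
  have hq0 (k : ℤ) (hk : k % 6 = 0 ∨ k % 6 = 2 ∨ k % 6 = 4) : quotExponent k = 0 := by
    rw [quotExponent, if_neg (by omega), if_neg (by omega)]
  by_cases h2 : (2 : ℤ) ∣ γ 1 0
  · have h3 : (3 : ℤ) ∣ γ 1 0 := by tauto
    obtain ⟨c, hc⟩ : ∃ c, γ 1 0 = 6 * c := ⟨γ 1 0 / 6, by omega⟩
    have n2 := not_dvd_of_isCoprime (isCoprime_left_col γ) (p := 2) (by norm_num) (by omega)
    have n3 := not_dvd_of_isCoprime (isCoprime_left_col γ) (p := 3) (by norm_num) (by omega)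
    refine hasLeading_w_of γ (g := 6) (M := 1) (g' := 6) (M' := 3) (c := c) (c' := c)
      (by norm_num) (by norm_num) (by norm_num) (by push_cast; omega)
      (by simp [isCoprime_one_left]) (by norm_num) (by norm_num) (by norm_num)
      (by push_cast; omega) (by exact_mod_cast isCoprime_three (c := c) (by omega)) ?_
    -- Here the contributions 6/24 and -(1/8)(6/3) cancel.
    have e1 : quotExponent ((1 : ℕ) * γ 0 0) = 1 / 24 := if_pos (by push_cast; omega)
    have e2 : quotExponent ((3 : ℕ) * γ 0 0) = -1 / 8 := by
      rw [quotExponent, if_neg (by push_cast; omega), if_pos (by push_cast; omega)]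
    rw [e1, e2]
    norm_num
  -- For an odd lower left entry both M and M' are even, so both exponents are 0.
  · by_cases h3 : (3 : ℤ) ∣ γ 1 0
    · obtain ⟨c, hc⟩ := h3
      have n3 := not_dvd_of_isCoprime (isCoprime_left_col γ) (p := 3) (by norm_num) (by omega)
      have c2 : IsCoprime (2 : ℤ) c := isCoprime_two (by omega)
      by_cases h9 : (3 : ℤ) ∣ c
      · obtain ⟨e, he⟩ := h9
        refine hasLeading_w_of γ (g := 3) (M := 2) (g' := 9) (M' := 2) (c := c) (c' := e)
          (by norm_num) (by norm_num) (by norm_num) (by push_cast; omega) (by exact_mod_cast c2)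
          (by norm_num) (by norm_num) (by norm_num) (by push_cast; omega)
          (by exact_mod_cast isCoprime_two (c := e) (by omega)) ?_
        rw [hq0 _ (by push_cast; omega)]
        norm_num
      · refine hasLeading_w_of γ (g := 3) (M := 2) (g' := 3) (M' := 6) (c := c) (c' := c)
          (by norm_num) (by norm_num) (by norm_num) (by push_cast; omega) (by exact_mod_cast c2)
          (by norm_num) (by norm_num) (by norm_num) (by push_cast; omega)
          (by simpa using c2.mul_left (isCoprime_three h9)) ?_
        rw [hq0 _ (by push_cast; omega), hq0 _ (by push_cast; omega)]
        norm_num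
    · have c2 := isCoprime_two h2
      have c3 := isCoprime_three h3
      refine hasLeading_w_of γ (g := 1) (M := 6) (g' := 1) (M' := 18) (c := γ 1 0) (c' := γ 1 0)
        (by norm_num) (by norm_num) (by norm_num) (by simp)
        (by simpa using c2.mul_left c3)
        (by norm_num) (by norm_num) (by norm_num) (by simp)
        (by simpa using c2.mul_left (c3.pow_left (m := 2))) ?_
      rw [hq0 _ (by push_cast; omega), hq0 _ (by push_cast; omega)]
      norm_num

/-! ### Widths of cusps and orders at cusps -/

theorem conj_T_pow_mem_iff (N : ℕ) (γ : SL(2, ℤ)) (h : ℕ) :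
    γ * ModularGroup.T ^ h * γ⁻¹ ∈ CongruenceSubgroup.Gamma0 N ↔ (N : ℤ) ∣ γ 1 0 ^ 2 * h := by
  have e : (γ * ModularGroup.T ^ h * γ⁻¹) 1 0 = -(γ 1 0 ^ 2 * h) := by
    rw [← zpow_natCast, Matrix.SpecialLinearGroup.coe_mul, Matrix.SpecialLinearGroup.coe_mul,
      Matrix.SpecialLinearGroup.coe_inv, Matrix.adjugate_fin_two, ModularGroup.coe_T_zpow]
    simp [Matrix.mul_apply, Fin.sum_univ_two]
    ring
  rw [CongruenceSubgroup.Gamma0_mem, ZMod.intCast_zmod_eq_zero_iff_dvd, e, dvd_neg]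

theorem cuspWidth_mem {N : ℕ} (hN : 0 < N) (γ : SL(2, ℤ)) :
    0 < cuspWidth N γ ∧
      γ * ModularGroup.T ^ cuspWidth N γ * γ⁻¹ ∈ CongruenceSubgroup.Gamma0 N :=
  Nat.sInf_mem (s := {h : ℕ | 0 < h ∧ γ * ModularGroup.T ^ h * γ⁻¹ ∈ CongruenceSubgroup.Gamma0 N})
    ⟨N, hN, (conj_T_pow_mem_iff N γ N).2 (dvd_mul_left _ _)⟩

theorem cuspWidth_eq {N : ℕ} (hN : 0 < N) (γ : SL(2, ℤ)) {h : ℕ} (hh : 0 < h)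
    (hiff : ∀ k : ℕ, (N : ℤ) ∣ γ 1 0 ^ 2 * k ↔ h ∣ k) : cuspWidth N γ = h := by
  apply le_antisymm
  · exact Nat.sInf_le ⟨hh, (conj_T_pow_mem_iff N γ h).2 ((hiff h).2 dvd_rfl)⟩
  · obtain ⟨h0, h1⟩ := cuspWidth_mem hN γ
    exact Nat.le_of_dvd h0 ((hiff _).1 ((conj_T_pow_mem_iff N γ _).1 h1))

theorem cuspWidth_of_dvd {γ : SL(2, ℤ)} (h : (18 : ℤ) ∣ γ 1 0) : cuspWidth 18 γ = 1 :=
  cuspWidth_eq (by norm_num) γ one_pos fun k ↦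
    ⟨fun _ ↦ one_dvd k, fun _ ↦ ((h.trans (dvd_pow_self _ two_ne_zero))).mul_right _⟩

theorem cuspWidth_of_two {γ : SL(2, ℤ)} (h : (2 : ℤ) ∣ γ 1 0) (h' : ¬ (3 : ℤ) ∣ γ 1 0) :
    cuspWidth 18 γ = 9 := by
  refine cuspWidth_eq (by norm_num) γ (by norm_num) fun k ↦ ⟨fun hk ↦ ?_, fun hk ↦ ?_⟩
  · have h9 : (9 : ℤ) ∣ γ 1 0 ^ 2 * k := (by norm_num : (9 : ℤ) ∣ (18 : ℕ)).trans hk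
    have hc : IsCoprime ((3 : ℤ) ^ 2) (γ 1 0 ^ 2) := (isCoprime_three h').pow
    have := hc.dvd_of_dvd_mul_left (by simpa using h9)
    norm_num at this
    exact_mod_cast this
  · obtain ⟨c, hc⟩ := h
    obtain ⟨j, rfl⟩ := hk
    exact ⟨2 * c ^ 2 * j, by rw [hc]; push_cast; ring⟩

/-- Translation by the width of the cusp. -/
theorem periodic_comp_smul {N : ℕ} {f : ℍ → ℂ}
    (hf : ∀ γ ∈ CongruenceSubgroup.Gamma0 N, ∀ τ : ℍ, f (γ • τ) = f τ) {γ : SL(2, ℤ)} {h : ℕ}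
    (hh : γ * ModularGroup.T ^ h * γ⁻¹ ∈ CongruenceSubgroup.Gamma0 N) (τ : ℍ) :
    f (γ • ((h : ℝ) +ᵥ τ)) = f (γ • τ) := by
  have h1 := modular_T_zpow_smul τ h
  rw [Int.cast_natCast, zpow_natCast] at h1
  rw [← h1, ← hf _ hh (γ • τ), mul_smul, mul_smul, inv_smul_smul]

theorem periodic_ofComplex {f : ℍ → ℂ} {h : ℝ} (hf : ∀ τ : ℍ, f (h +ᵥ τ) = f τ) :
    Function.Periodic (f ∘ ofComplex) h := by
  intro z
  by_cases hz : 0 < z.im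
  · have hz' : 0 < (z + h).im := by simpa using hz
    have : ofComplex (z + h) = h +ᵥ ofComplex z := by
      apply UpperHalfPlane.ext
      rw [ofComplex_apply_of_im_pos hz', coe_vadd, ofComplex_apply_of_im_pos hz, coe_mk, coe_mk,
        add_comm]
    rw [Function.comp_apply, this, hf, Function.comp_apply]
  · have hz' : (z + h).im ≤ 0 := by simpa using not_lt.1 hz
    rw [Function.comp_apply, Function.comp_apply, ofComplex_apply_of_im_nonpos hz',
      ofComplex_apply_of_im_nonpos (not_lt.1 hz)]

/-- The Möbius transformation of `γ` as a function of a complex variable. -/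
def moebius (γ : SL(2, ℤ)) (z : ℂ) : ℂ := (γ 0 0 * z + γ 0 1) / (γ 1 0 * z + γ 1 1)

theorem moebius_coe (γ : SL(2, ℤ)) (τ : ℍ) : moebius γ τ = ((γ • τ : ℍ) : ℂ) :=
  (coe_smul_eq γ τ).symm

theorem hasDerivAt_moebius (γ : SL(2, ℤ)) (τ : ℍ) :
    HasDerivAt (moebius γ) (1 / (γ 1 0 * τ + γ 1 1 : ℂ) ^ 2) τ := by
  have h0 := denom_ne_zero' γ τ
  have hn : HasDerivAt (fun z : ℂ ↦ (γ 0 0 * z + γ 0 1 : ℂ)) (γ 0 0) τ := by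
    simpa using ((hasDerivAt_id (τ : ℂ)).const_mul (γ 0 0 : ℂ)).add_const (γ 0 1 : ℂ)
  have hd : HasDerivAt (fun z : ℂ ↦ (γ 1 0 * z + γ 1 1 : ℂ)) (γ 1 0) τ := by
    simpa using ((hasDerivAt_id (τ : ℂ)).const_mul (γ 1 0 : ℂ)).add_const (γ 1 1 : ℂ)
  have hdet : (γ 0 0 : ℂ) * γ 1 1 - γ 0 1 * γ 1 0 = 1 := by exact_mod_cast det_eq_one γ
  convert! hn.div hd h0 using 1
  rw [← hdet]
  ring

theorem analyticAt_moebius (γ : SL(2, ℤ)) (τ : ℍ) : AnalyticAt ℂ (moebius γ) τ :=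
  AnalyticAt.div (by fun_prop) (by fun_prop) (denom_ne_zero' γ τ)

theorem comp_smul_ofComplex (f : ℍ → ℂ) (γ : SL(2, ℤ)) {z : ℂ} (hz : 0 < z.im) :
    f (γ • ofComplex z) = (f ∘ ofComplex) (moebius γ z) := by
  obtain ⟨τ, rfl⟩ : ∃ τ : ℍ, (τ : ℂ) = z := ⟨⟨z, hz⟩, rfl⟩
  rw [Function.comp_apply, moebius_coe, ofComplex_apply, ofComplex_apply]

theorem isOpen_im_pos : IsOpen {z : ℂ | 0 < z.im} :=
  isOpen_lt continuous_const Complex.continuous_im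

theorem differentiableOn_comp_smul {f : ℍ → ℂ}
    (hf : DifferentiableOn ℂ (f ∘ ofComplex) {z : ℂ | 0 < z.im}) (γ : SL(2, ℤ)) :
    DifferentiableOn ℂ ((fun τ ↦ f (γ • τ)) ∘ ofComplex) {z : ℂ | 0 < z.im} := by
  have h : DifferentiableOn ℂ ((f ∘ ofComplex) ∘ moebius γ) {z : ℂ | 0 < z.im} := by
    refine hf.comp (fun z hz ↦ ?_) fun z hz ↦ ?_
    · exact (hasDerivAt_moebius γ ⟨z, hz⟩).differentiableAt.differentiableWithinAt
    · exact (moebius_coe γ ⟨z, hz⟩).symm ▸ (γ • (⟨z, hz⟩ : ℍ)).im_pos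
  exact h.congr fun z hz ↦ comp_smul_ofComplex f γ hz

/-- The order at a cusp read off from the leading exponent. -/
theorem meromorphicOrderAt_expansionAtCusp {N : ℕ} (hN : 0 < N) {f : ℍ → ℂ}
    (hf : DifferentiableOn ℂ (f ∘ ofComplex) {z : ℂ | 0 < z.im})
    (hinv : ∀ γ ∈ CongruenceSubgroup.Gamma0 N, ∀ τ : ℍ, f (γ • τ) = f τ) (γ : SL(2, ℤ)) {n : ℤ}
    (hlead : HasLeading (fun τ ↦ f (γ • τ)) (n / cuspWidth N γ)) :
    MeromorphicAt (expansionAtCusp N f γ) 0 ∧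
      meromorphicOrderAt (expansionAtCusp N f γ) 0 = n := by
  obtain ⟨h0, hmem⟩ := cuspWidth_mem hN γ
  set h := cuspWidth N γ with hh
  have h0' : (0 : ℝ) < h := by exact_mod_cast h0
  obtain ⟨C, hC, hlim⟩ := hlead
  have hper := periodic_ofComplex (f := fun τ ↦ f (γ • τ)) (periodic_comp_smul hinv hmem)
  have hdiff := differentiableOn_comp_smul hf γ
  have hdiff' : ∀ᶠ z in comap Complex.im atTop, DifferentiableAt ℂ
      ((fun τ ↦ f (γ • τ)) ∘ ofComplex) z := by
    filter_upwards [preimage_mem_comap (Ioi_mem_atTop 0)] with z hz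
    exact hdiff.differentiableAt (isOpen_im_pos.mem_nhds hz)
  have h1 := Function.Periodic.eventually_differentiableAt_cuspFunction_nhds_ne_zero h0' hper hdiff'
  set F := expansionAtCusp N f γ with hF
  -- In the local parameter q = exp(2π i τ / h), the factor exp(-2π i (n/h) τ) is q^(-n).
  have h2 : Tendsto (fun q ↦ F q * q ^ (-n)) (𝓝[≠] 0) (𝓝 C) := by
    have hi := Function.Periodic.invQParam_tendsto h0'
    refine (hlim.comp (tendsto_comap_im_ofComplex.comp hi)).congr' ?_
    filter_upwards [self_mem_nhdsWithin, hi.eventually (preimage_mem_comap (Ioi_mem_atTop 0))]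
      with q hq hq'
    rw [hF, expansionAtCusp_apply N f γ hq]
    simp only [Function.comp_apply]
    congr 1
    conv_rhs => rw [← Function.Periodic.qParam_right_inv h0'.ne' hq]
    rw [ofComplex_apply_of_im_pos hq', Function.Periodic.qParam, ← Complex.exp_int_mul]
    congr 1
    push_cast
    ring
  -- The singularity at 0 is removable, and the value C ≠ 0 there makes the order exactly n.
  set G : ℂ → ℂ := Function.update (fun q ↦ F q * q ^ (-n)) 0 C with hG
  have hGe : ∀ᶠ q in 𝓝[≠] (0 : ℂ), G q = F q * q ^ (-n) := by
    filter_upwards [self_mem_nhdsWithin] with q hq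
    exact Function.update_of_ne hq _ _
  have hGa : AnalyticAt ℂ G 0 := by
    apply Complex.analyticAt_of_differentiable_on_punctured_nhds_of_continuousAt
    · filter_upwards [h1, self_mem_nhdsWithin] with q hq hq0
      have : DifferentiableAt ℂ (fun q ↦ F q * q ^ (-n)) q :=
        DifferentiableAt.mul hq (differentiableAt_zpow.2 (Or.inl hq0))
      refine this.congr_of_eventuallyEq ?_
      filter_upwards [isOpen_ne.mem_nhds hq0] with y hy
      exact Function.update_of_ne hy _ _
    · rw [hG, continuousAt_update_same]
      exact h2
  have hFG : ∀ᶠ q in 𝓝[≠] (0 : ℂ), F q = (q - 0) ^ n • G q := by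
    filter_upwards [hGe, self_mem_nhdsWithin] with q hq hq0
    rw [hq, sub_zero, smul_eq_mul, mul_left_comm, ← zpow_add₀ hq0, add_neg_cancel, zpow_zero,
      mul_one]
  have hFm : MeromorphicAt F 0 := by
    refine MeromorphicAt.congr (f := fun q ↦ (q - 0) ^ n • G q) ?_ ?_
    · exact ((MeromorphicAt.id 0).sub (MeromorphicAt.const 0 0)).zpow n |>.smul hGa.meromorphicAt
    · filter_upwards [hFG] with q hq using hq.symm
  refine ⟨hFm, (meromorphicOrderAt_eq_int_iff hFm).2 ⟨G, hGa, ?_, hFG⟩⟩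
  simpa [hG] using hC

theorem isModularFunction_of_hasLeading {N : ℕ} (hN : 0 < N) {f : ℍ → ℂ}
    (hf : DifferentiableOn ℂ (f ∘ ofComplex) {z : ℂ | 0 < z.im})
    (hinv : ∀ γ ∈ CongruenceSubgroup.Gamma0 N, ∀ τ : ℍ, f (γ • τ) = f τ)
    (hlead : ∀ γ : SL(2, ℤ), ∃ n : ℤ, HasLeading (fun τ ↦ f (γ • τ)) (n / cuspWidth N γ)) :
    IsModularFunction N f where
  meromorphic z hz := (hf.analyticAt (isOpen_im_pos.mem_nhds hz)).meromorphicAt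
  invariant := hinv
  meromorphic_cusps γ := by
    obtain ⟨n, hn⟩ := hlead γ
    exact (meromorphicOrderAt_expansionAtCusp hN hf hinv γ hn).1

theorem order_w_of_dvd {γ : SL(2, ℤ)} (h : (18 : ℤ) ∣ γ 1 0) :
    HasLeading (fun τ ↦ w (γ • τ)) ((1 : ℤ) / cuspWidth 18 γ) := by
  rw [cuspWidth_of_dvd h]
  simpa using hasLeading_w_one h

theorem order_w_of_two {γ : SL(2, ℤ)} (h : (2 : ℤ) ∣ γ 1 0) (h' : ¬ (3 : ℤ) ∣ γ 1 0) :
    HasLeading (fun τ ↦ w (γ • τ)) ((-1 : ℤ) / cuspWidth 18 γ) := by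
  rw [cuspWidth_of_two h h']
  simpa using hasLeading_w_two h h'

theorem order_w_of_not {γ : SL(2, ℤ)} (h : ¬ (18 : ℤ) ∣ γ 1 0)
    (h' : ¬ ((2 : ℤ) ∣ γ 1 0 ∧ ¬ (3 : ℤ) ∣ γ 1 0)) :
    HasLeading (fun τ ↦ w (γ • τ)) ((0 : ℤ) / cuspWidth 18 γ) := by
  simpa using hasLeading_w_zero h h'

theorem isModularFunction_w : IsModularFunction 18 w := by
  refine isModularFunction_of_hasLeading (by norm_num) differentiableOn_w (fun _ h ↦ w_smul h)
    fun γ ↦ ?_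
  by_cases h : (18 : ℤ) ∣ γ 1 0
  · exact ⟨1, order_w_of_dvd h⟩
  by_cases h' : (2 : ℤ) ∣ γ 1 0 ∧ ¬ (3 : ℤ) ∣ γ 1 0
  · exact ⟨-1, order_w_of_two h'.1 h'.2⟩
  · exact ⟨0, order_w_of_not h h'⟩

/-! ### Equivalence of cusps -/

theorem mem_Gamma0_18_iff {γ : SL(2, ℤ)} :
    γ ∈ CongruenceSubgroup.Gamma0 18 ↔ (18 : ℤ) ∣ γ 1 0 := by
  rw [CongruenceSubgroup.Gamma0_mem]
  exact ZMod.intCast_zmod_eq_zero_iff_dvd _ 18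

theorem smul_infty_eq_iff {γ δ : SL(2, ℤ)} :
    Matrix.SpecialLinearGroup.mapGL ℚ γ • (OnePoint.infty : OnePoint ℚ) =
      Matrix.SpecialLinearGroup.mapGL ℚ δ • (OnePoint.infty : OnePoint ℚ) ↔ (δ⁻¹ * γ) 1 0 = 0 := by
  rw [← inv_smul_eq_iff, ← mul_smul, ← map_inv, ← map_mul, OnePoint.smul_infty_eq_self_iff]
  generalize δ⁻¹ * γ = ε
  simp

/-- The matrix that maps `∞` to `1/2`. -/
def halfMatrix : SL(2, ℤ) := ⟨!![1, 0; 2, 1], by simp⟩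

theorem halfMatrix_smul_infty :
    Matrix.SpecialLinearGroup.mapGL ℚ halfMatrix • (OnePoint.infty : OnePoint ℚ) =
      ((1 / 2 : ℚ) : OnePoint ℚ) := by
  have h0 : halfMatrix 0 0 = 1 := rfl
  have h1 : halfMatrix 1 0 = 2 := rfl
  rw [OnePoint.smul_infty_eq_ite]
  simp [h0, h1]

theorem eq_one_or_of_lower_left_eq_zero {u : SL(2, ℤ)} (hu : u 1 0 = 0) :
    u 0 0 = 1 ∨ u 0 0 = -1 := by
  have h := det_eq_one u
  rw [hu, mul_zero, sub_zero] at h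
  exact Int.isUnit_iff.1 (IsUnit.of_mul_eq_one _ h)

theorem cuspEquiv_infty_iff {γ : SL(2, ℤ)} {r : OnePoint ℚ}
    (hr : Matrix.SpecialLinearGroup.mapGL ℚ γ • (OnePoint.infty : OnePoint ℚ) = r) :
    CuspEquiv 18 OnePoint.infty r ↔ (18 : ℤ) ∣ γ 1 0 := by
  constructor
  · rintro ⟨ε, hε, h⟩
    rw [mem_Gamma0_18_iff] at hε
    have h0 := smul_infty_eq_iff.1 (hr.trans h.symm)
    have e : γ 1 0 = (ε * (ε⁻¹ * γ)) 1 0 := by rw [mul_inv_cancel_left]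
    rw [e, Matrix.SpecialLinearGroup.coe_mul, Matrix.mul_apply, Fin.sum_univ_two, h0, mul_zero,
      add_zero]
    exact hε.mul_right _
  · exact fun h ↦ ⟨γ, mem_Gamma0_18_iff.2 h, hr⟩

theorem cuspEquiv_half_iff {γ : SL(2, ℤ)} {r : OnePoint ℚ}
    (hr : Matrix.SpecialLinearGroup.mapGL ℚ γ • (OnePoint.infty : OnePoint ℚ) = r) :
    CuspEquiv 18 ((1 / 2 : ℚ) : OnePoint ℚ) r ↔ (2 : ℤ) ∣ γ 1 0 ∧ ¬ (3 : ℤ) ∣ γ 1 0 := by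
  constructor
  · rintro ⟨ε, hε, h⟩
    rw [mem_Gamma0_18_iff] at hε
    rw [← halfMatrix_smul_infty, ← mul_smul, ← map_mul] at h
    have h0 := smul_infty_eq_iff.1 (hr.trans h.symm)
    have e : γ 1 0 = ((ε * halfMatrix) * ((ε * halfMatrix)⁻¹ * γ)) 1 0 := by
      rw [mul_inv_cancel_left]
    have h3 := not_dvd_of_isCoprime (p := 3) (a := ε 1 1) (c := ε 1 0)
      ⟨ε 0 0, -ε 0 1, by linear_combination det_eq_one ε⟩ (by norm_num)
      ((by norm_num : (3 : ℤ) ∣ 18).trans hε)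
    have hu := eq_one_or_of_lower_left_eq_zero h0
    have e' : (ε * halfMatrix) 1 0 = ε 1 0 + 2 * ε 1 1 := by
      rw [Matrix.SpecialLinearGroup.coe_mul, Matrix.mul_apply, Fin.sum_univ_two]
      simp [halfMatrix, mul_comm]
    rw [Matrix.SpecialLinearGroup.coe_mul, Matrix.mul_apply, Fin.sum_univ_two, h0, mul_zero,
      add_zero, e'] at e
    -- Here γ 1 0 = ±(ε 1 0 + 2 ε 1 1), where 18 divides ε 1 0 and 3 does not divide ε 1 1.
    rcases hu with hu | hu <;> rw [hu] at e <;> omega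
  · rintro ⟨h2, h3⟩
    obtain ⟨c, hc⟩ := h2
    have hcop : IsCoprime ((3 : ℤ) ^ 2) (2 * c) := (hc ▸ isCoprime_three h3).pow_left
    obtain ⟨u, v, huv⟩ := hcop
    -- The lower left entry is divisible by 18 when 2 c j ≡ c - γ 1 1 modulo 9, and v inverts 2 c
    -- modulo 9.
    set j := v * (c - γ 1 1) with hj
    refine ⟨γ * ModularGroup.T ^ j * halfMatrix⁻¹, ?_, ?_⟩
    · have e : (γ * ModularGroup.T ^ j * halfMatrix⁻¹) 1 0 =
          γ 1 0 - 2 * (γ 1 0 * j + γ 1 1) := by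
        rw [Matrix.SpecialLinearGroup.coe_mul, Matrix.SpecialLinearGroup.coe_mul,
          Matrix.SpecialLinearGroup.coe_inv, Matrix.adjugate_fin_two, ModularGroup.coe_T_zpow]
        simp [halfMatrix, Matrix.mul_apply, Fin.sum_univ_two]
        ring
      rw [mem_Gamma0_18_iff, e, hc, hj]
      exact ⟨u * (c - γ 1 1), by linear_combination (-2 * (c - γ 1 1)) * huv⟩
    · rw [← halfMatrix_smul_infty, ← mul_smul, ← map_mul, inv_mul_cancel_right, ← hr,
        smul_infty_eq_iff, inv_mul_cancel_left, ModularGroup.coe_T_zpow]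
      rfl

/-- The orders of `w` at the cusps. -/
theorem hasOrderAtCusp_w (r : OnePoint ℚ) :
    (CuspEquiv 18 OnePoint.infty r → HasOrderAtCusp 18 w r 1) ∧
    (CuspEquiv 18 ((1 / 2 : ℚ) : OnePoint ℚ) r → HasOrderAtCusp 18 w r (-1)) ∧
    (¬ CuspEquiv 18 OnePoint.infty r → ¬ CuspEquiv 18 ((1 / 2 : ℚ) : OnePoint ℚ) r →
      HasOrderAtCusp 18 w r 0) := by
  have key (γ : SL(2, ℤ)) (n : ℤ) := meromorphicOrderAt_expansionAtCusp (by norm_num)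
    differentiableOn_w (fun _ h ↦ w_smul h) γ (n := n)
  refine ⟨fun h γ hγ ↦ ?_, fun h γ hγ ↦ ?_, fun h h' γ hγ ↦ ?_⟩
  · rw [cuspEquiv_infty_iff hγ] at h
    exact key γ 1 (order_w_of_dvd h)
  · rw [cuspEquiv_half_iff hγ] at h
    exact key γ (-1) (order_w_of_two h.1 h.2)
  · rw [cuspEquiv_infty_iff hγ] at h
    rw [cuspEquiv_half_iff hγ] at h'
    exact key γ 0 (order_w_of_not h h')

/-! ### Holomorphic functions invariant under `Γ₀(N)` -/

/-- A holomorphic function invariant under `Γ₀(N)` and bounded at all cusps is constant. -/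
theorem exists_eq_const_of_bounded {N : ℕ} [NeZero N] {g : ℍ → ℂ}
    (hd : DifferentiableOn ℂ (g ∘ ofComplex) {z : ℂ | 0 < z.im})
    (hinv : ∀ γ ∈ CongruenceSubgroup.Gamma0 N, ∀ τ : ℍ, g (γ • τ) = g τ)
    (hb : ∀ γ : SL(2, ℤ), IsBoundedAtImInfty fun τ ↦ g (γ • τ)) : ∃ c, ∀ τ, g τ = c := by
  let F : ModularForm ((CongruenceSubgroup.Gamma0 N).map (Matrix.SpecialLinearGroup.mapGL ℝ)) 0 :=
    { toFun := g
      slash_action_eq' := by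
        rintro _ ⟨γ, hγ, rfl⟩
        ext τ
        have : (g ∣[(0 : ℤ)] γ) τ = g τ := by
          rw [ModularForm.SL_slash_apply, hinv γ hγ]
          simp
        exact this
      holo' := UpperHalfPlane.mdifferentiable_iff.2 hd
      bdd_at_cusps' := by
        intro c hc
        rw [Subgroup.IsArithmetic.isCusp_iff_isCusp_SL2Z] at hc
        rw [OnePoint.isBoundedAt_iff_forall_SL2Z hc]
        intro γ _
        have : (g ∣[(0 : ℤ)] γ) = fun τ ↦ g (γ • τ) := by
          ext τ
          rw [ModularForm.SL_slash_apply]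
          simp
        rw [this]
        exact hb γ }
  obtain ⟨c, hc⟩ := ModularForm.eq_const_of_weight_zero F
  exact ⟨c, fun τ ↦ congrFun hc τ⟩

theorem norm_qParam_eq (h : ℝ) (τ : ℍ) :
    ‖Function.Periodic.qParam h τ‖ = Real.exp (-2 * Real.pi * τ.im / h) := by
  rw [Function.Periodic.norm_qParam]
  rfl

/-- A bounded periodic holomorphic function converges at `i∞`, at the rate of the local
parameter. -/
theorem exists_tendsto_of_bounded {f : ℍ → ℂ} {h : ℝ} (hh : 0 < h)
    (hper : ∀ τ : ℍ, f (h +ᵥ τ) = f τ)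
    (hd : DifferentiableOn ℂ (f ∘ ofComplex) {z : ℂ | 0 < z.im}) (hb : IsBoundedAtImInfty f) :
    ∃ L, Tendsto f atImInfty (𝓝 L) ∧
      (fun τ ↦ f τ - L) =O[atImInfty] fun τ ↦ Function.Periodic.qParam h τ := by
  have h1 := exp_decay_sub_atImInfty hh (periodic_ofComplex hper)
    (UpperHalfPlane.mdifferentiable_iff.2 hd) hb
  have h2 : (fun τ ↦ f τ - valueAtInfty f) =O[atImInfty]
      fun τ ↦ Function.Periodic.qParam h τ := by
    rw [← Asymptotics.isBigO_norm_right]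
    simpa only [norm_qParam_eq] using h1
  refine ⟨valueAtInfty f, ?_, h2⟩
  have h3 := h2.trans_tendsto (qParam_tendsto_atImInfty hh)
  simpa using h3.add_const (valueAtInfty f)

theorem isBoundedAtImInfty_mul {f g : ℍ → ℂ} (hf : IsBoundedAtImInfty f)
    (hg : IsBoundedAtImInfty g) : IsBoundedAtImInfty fun τ ↦ f τ * g τ := by
  exact (Asymptotics.IsBigO.mul hf hg).congr_right fun τ ↦ by simp

theorem isBoundedAtImInfty_sub {f g : ℍ → ℂ} (hf : IsBoundedAtImInfty f)
    (hg : IsBoundedAtImInfty g) : IsBoundedAtImInfty fun τ ↦ f τ - g τ :=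
  Asymptotics.IsBigO.sub hf hg

theorem isBoundedAtImInfty_pow {f : ℍ → ℂ} (hf : IsBoundedAtImInfty f) (n : ℕ) :
    IsBoundedAtImInfty fun τ ↦ f τ ^ n := by
  exact (Asymptotics.IsBigO.pow hf n).congr_right fun τ ↦ by simp

theorem isBoundedAtImInfty_of_tendsto {f : ℍ → ℂ} {L : ℂ} (hf : Tendsto f atImInfty (𝓝 L)) :
    IsBoundedAtImInfty f :=
  hf.isBigO_one ℝ

theorem isBoundedAtImInfty_const (c : ℂ) : IsBoundedAtImInfty fun _ ↦ c :=
  isBoundedAtImInfty_of_tendsto tendsto_const_nhds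

theorem isBoundedAtImInfty_eval {f : ℍ → ℂ} (hf : IsBoundedAtImInfty f) (P : Polynomial ℂ) :
    IsBoundedAtImInfty fun τ ↦ P.eval (f τ) := by
  induction P using Polynomial.induction_on' with
  | add p q hp hq =>
    simp only [Polynomial.eval_add]
    exact Asymptotics.IsBigO.add hp hq
  | monomial n a =>
    simp only [Polynomial.eval_monomial]
    exact isBoundedAtImInfty_mul (isBoundedAtImInfty_const a) (isBoundedAtImInfty_pow hf n)

theorem HasLeading.isBoundedAtImInfty {F : ℍ → ℂ} {κ : ℝ} (hF : HasLeading F κ) (hκ : 0 ≤ κ) :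
    IsBoundedAtImInfty F := by
  obtain ⟨C, -, hC⟩ := hF
  have h1 := isBoundedAtImInfty_of_tendsto hC
  have h2 : IsBoundedAtImInfty fun τ : ℍ ↦ Complex.exp (2 * Real.pi * Complex.I * (κ * τ)) := by
    refine Asymptotics.IsBigO.of_bound 1 (Eventually.of_forall fun τ ↦ ?_)
    rw [norm_exp_two_pi_I]
    have : 0 ≤ κ * τ.im := mul_nonneg hκ τ.im_pos.le
    have := Real.pi_pos
    simp only [Complex.im_ofReal_mul, Pi.one_apply, norm_one, mul_one, Real.exp_le_one_iff,
      coe_im]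
    nlinarith
  have h3 := isBoundedAtImInfty_mul h1 h2
  convert! h3 using 2 with τ
  rw [mul_assoc, ← Complex.exp_add, show -(2 * Real.pi * Complex.I * κ * (τ : ℂ)) +
    2 * Real.pi * Complex.I * (κ * τ) = 0 by ring, Complex.exp_zero, mul_one]

/-! ### Invariant functions holomorphic outside the cusp `1/2` -/

/-- The cusps `γ ∞` equivalent to `1/2`. -/
def IsHalf (γ : SL(2, ℤ)) : Prop := (2 : ℤ) ∣ γ 1 0 ∧ ¬ (3 : ℤ) ∣ γ 1 0

theorem isBounded_w_of_not_isHalf {γ : SL(2, ℤ)} (h : ¬ IsHalf γ) :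
    IsBoundedAtImInfty fun τ ↦ w (γ • τ) := by
  by_cases h' : (18 : ℤ) ∣ γ 1 0
  · exact (hasLeading_w_one h').isBoundedAtImInfty zero_le_one
  · exact (hasLeading_w_zero h' h).isBoundedAtImInfty le_rfl

theorem tendsto_smul_atImInfty_of_lower_left {u : SL(2, ℤ)} (hu : u 1 0 = 0) :
    Tendsto (fun τ : ℍ ↦ u • τ) atImInfty atImInfty := by
  have := tendsto_smul_atImInfty (g := Matrix.SpecialLinearGroup.mapGL ℝ u) (by simpa using hu)
  exact this

/-- These cusps form one orbit: γ is `halfMatrix` up to Γ₀(18) on the left and a stabiliser of ∞ on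
the right, which preserves the approach to i∞. -/
theorem isBounded_of_isHalf {g : ℍ → ℂ}
    (hinv : ∀ γ ∈ CongruenceSubgroup.Gamma0 18, ∀ τ : ℍ, g (γ • τ) = g τ)
    (hb : IsBoundedAtImInfty fun τ ↦ g (halfMatrix • τ)) {γ : SL(2, ℤ)} (hγ : IsHalf γ) :
    IsBoundedAtImInfty fun τ ↦ g (γ • τ) := by
  obtain ⟨ε, hε, h⟩ := (cuspEquiv_half_iff (γ := γ) rfl).2 hγ
  rw [← halfMatrix_smul_infty, ← mul_smul, ← map_mul] at h
  have hu := smul_infty_eq_iff.1 h.symm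
  set u := (ε * halfMatrix)⁻¹ * γ with hu'
  have hγ' : γ = ε * (halfMatrix * u) := by rw [hu']; group
  have h1 := Asymptotics.IsBigO.comp_tendsto hb (tendsto_smul_atImInfty_of_lower_left hu)
  have h2 : (fun τ ↦ g (γ • τ)) = (fun τ ↦ g (halfMatrix • τ)) ∘ fun τ ↦ u • τ := by
    ext τ
    rw [hγ', mul_smul, hinv ε hε, mul_smul]
    rfl
  rw [h2]
  exact h1

theorem isHalf_halfMatrix : IsHalf halfMatrix := by
  have h : halfMatrix 1 0 = 2 := rfl
  rw [IsHalf, h]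
  norm_num

theorem tendsto_w_halfMatrix : ∃ C : ℂ, C ≠ 0 ∧ Tendsto
    (fun τ : ℍ ↦ w (halfMatrix • τ) * Function.Periodic.qParam 9 τ) atImInfty (𝓝 C) := by
  obtain ⟨C, hC, h⟩ := hasLeading_w_two isHalf_halfMatrix.1 isHalf_halfMatrix.2
  refine ⟨C, hC, h.congr fun τ ↦ ?_⟩
  rw [Function.Periodic.qParam]
  congr 2
  push_cast
  ring

theorem halfMatrix_vadd {g : ℍ → ℂ}
    (hinv : ∀ γ ∈ CongruenceSubgroup.Gamma0 18, ∀ τ : ℍ, g (γ • τ) = g τ) (τ : ℍ) :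
    g (halfMatrix • ((9 : ℝ) +ᵥ τ)) = g (halfMatrix • τ) := by
  have h := (cuspWidth_mem (N := 18) (by norm_num) halfMatrix).2
  rw [cuspWidth_of_two isHalf_halfMatrix.1 isHalf_halfMatrix.2] at h
  exact_mod_cast periodic_comp_smul hinv h τ

theorem qParam_vadd {h : ℝ} (hh : h ≠ 0) (τ : ℍ) :
    Function.Periodic.qParam h ((h +ᵥ τ : ℍ) : ℂ) = Function.Periodic.qParam h τ := by
  have hC : (h : ℂ) ≠ 0 := by exact_mod_cast hh
  rw [Function.Periodic.qParam, Function.Periodic.qParam, coe_vadd,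
    Complex.exp_eq_exp_iff_exists_int]
  exact ⟨1, by push_cast; field_simp; ring⟩

/-- A holomorphic `Γ₀(18)`-invariant function whose only pole is the cusp `1/2` is a polynomial in
`w`. -/
theorem exists_polynomial_eq {g : ℍ → ℂ}
    (hd : DifferentiableOn ℂ (g ∘ ofComplex) {z : ℂ | 0 < z.im})
    (hinv : ∀ γ ∈ CongruenceSubgroup.Gamma0 18, ∀ τ : ℍ, g (γ • τ) = g τ)
    (hb : ∀ γ : SL(2, ℤ), ¬ IsHalf γ → IsBoundedAtImInfty fun τ ↦ g (γ • τ)) (n : ℕ)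
    (hn : IsBoundedAtImInfty fun τ ↦ g (halfMatrix • τ) * Function.Periodic.qParam 9 τ ^ n) :
    ∃ P : Polynomial ℂ, ∀ τ, g τ = P.eval (w τ) := by
  induction n generalizing g with
  | zero =>
    simp only [pow_zero, mul_one] at hn
    obtain ⟨c, hc⟩ := exists_eq_const_of_bounded (N := 18) hd hinv fun γ ↦ by
      by_cases h : IsHalf γ
      · exact isBounded_of_isHalf hinv hn h
      · exact hb γ h
    exact ⟨Polynomial.C c, fun τ ↦ by simp [hc τ]⟩
  | succ n ih =>
    obtain ⟨C, hC, hw⟩ := tendsto_w_halfMatrix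
    have hdq : DifferentiableOn ℂ ((fun τ : ℍ ↦ Function.Periodic.qParam 9 τ ^ (n + 1)) ∘ ofComplex)
        {z : ℂ | 0 < z.im} := by
      refine DifferentiableOn.congr (f := fun z ↦ Function.Periodic.qParam 9 z ^ (n + 1)) ?_ ?_
      · exact (Function.Periodic.differentiable_qParam.pow _).differentiableOn
      · intro z hz
        rw [Function.comp_apply, ofComplex_apply_of_im_pos hz]
    have hdiff {f : ℍ → ℂ} (hf : DifferentiableOn ℂ (f ∘ ofComplex) {z : ℂ | 0 < z.im}) :
        DifferentiableOn ℂ ((fun τ : ℍ ↦ f (halfMatrix • τ) *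
          Function.Periodic.qParam 9 τ ^ (n + 1)) ∘ ofComplex) {z : ℂ | 0 < z.im} :=
      (differentiableOn_comp_smul hf halfMatrix).mul hdq
    have hper {f : ℍ → ℂ} (hf : ∀ γ ∈ CongruenceSubgroup.Gamma0 18, ∀ τ : ℍ, f (γ • τ) = f τ)
        (τ : ℍ) : f (halfMatrix • ((9 : ℝ) +ᵥ τ)) *
          Function.Periodic.qParam 9 ((9 : ℝ) +ᵥ τ : ℍ) ^ (n + 1) =
        f (halfMatrix • τ) * Function.Periodic.qParam 9 τ ^ (n + 1) := by
      rw [halfMatrix_vadd hf, qParam_vadd (by norm_num)]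
    obtain ⟨L, hL, -⟩ := exists_tendsto_of_bounded (by norm_num : (0 : ℝ) < 9) (hper hinv)
      (hdiff hd) hn
    -- The multiple of w^(n+1) that cancels the leading coefficient at 1/2.
    set a := L / C ^ (n + 1) with ha
    set g' : ℍ → ℂ := fun τ ↦ g τ - a * w τ ^ (n + 1) with hg'
    have hd' : DifferentiableOn ℂ (g' ∘ ofComplex) {z : ℂ | 0 < z.im} :=
      hd.sub ((differentiableOn_w.pow (n + 1)).const_mul a)
    have hinv' : ∀ γ ∈ CongruenceSubgroup.Gamma0 18, ∀ τ : ℍ, g' (γ • τ) = g' τ :=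
      fun γ hγ τ ↦ by simp only [hg', hinv γ hγ, w_smul hγ]
    have hb' (γ : SL(2, ℤ)) (hγ : ¬ IsHalf γ) : IsBoundedAtImInfty fun τ ↦ g' (γ • τ) :=
      isBoundedAtImInfty_sub (hb γ hγ) (isBoundedAtImInfty_mul (isBoundedAtImInfty_const a)
        (isBoundedAtImInfty_pow (isBounded_w_of_not_isHalf hγ) (n + 1)))
    have hlim : Tendsto (fun τ : ℍ ↦ g' (halfMatrix • τ) *
        Function.Periodic.qParam 9 τ ^ (n + 1)) atImInfty (𝓝 0) := by
      have := hL.sub ((hw.pow (n + 1)).const_mul a)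
      rw [ha, div_mul_cancel₀ _ (pow_ne_zero _ hC), sub_self] at this
      refine this.congr fun τ ↦ ?_
      simp only [hg']
      ring
    obtain ⟨L', hL', hO⟩ := exists_tendsto_of_bounded (by norm_num : (0 : ℝ) < 9) (hper hinv')
      (hdiff hd') (isBoundedAtImInfty_of_tendsto hlim)
    -- With limit 0 the function is of the order of the local parameter itself, so one power can be
    -- divided out.
    rw [tendsto_nhds_unique hL' hlim] at hO
    have hn' : IsBoundedAtImInfty fun τ ↦ g' (halfMatrix • τ) *
        Function.Periodic.qParam 9 τ ^ n := by
      have h1 := hO.mul (Asymptotics.isBigO_refl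
        (fun τ : ℍ ↦ (Function.Periodic.qParam 9 (τ : ℂ))⁻¹) atImInfty)
      have h0 (τ : ℍ) : Function.Periodic.qParam 9 (τ : ℂ) ≠ 0 :=
        Function.Periodic.qParam_ne_zero _
      rw [IsBoundedAtImInfty, BoundedAtFilter, ← Asymptotics.isBigO_norm_right]
      rw [← Asymptotics.isBigO_norm_right] at h1
      refine h1.congr (fun τ ↦ ?_) fun τ ↦ ?_
      · rw [sub_zero, pow_succ, ← mul_assoc, mul_inv_cancel_right₀ (h0 τ)]
      · rw [mul_inv_cancel₀ (h0 τ)]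
        simp
    obtain ⟨P, hP⟩ := ih hd' hinv' hb' hn'
    refine ⟨P + Polynomial.C a * Polynomial.X ^ (n + 1), fun τ ↦ ?_⟩
    have := hP τ
    simp only [hg'] at this
    simp [← this]

/-! ### Growth at the cusps and poles of modular functions -/

/-- The quotient consists of left cosets; inverting representatives gives the right cosets needed
here. -/
theorem exists_finset_Gamma0_cosets (N : ℕ) [NeZero N] : ∃ R : Finset SL(2, ℤ), ∀ γ : SL(2, ℤ),
    ∃ δ ∈ CongruenceSubgroup.Gamma0 N, ∃ ρ ∈ R, γ = δ * ρ := by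
  classical
  let _ := (CongruenceSubgroup.Gamma0 N).fintypeQuotientOfFiniteIndex
  refine ⟨Finset.univ.image fun x : SL(2, ℤ) ⧸ CongruenceSubgroup.Gamma0 N ↦ (Quotient.out x)⁻¹,
    fun γ ↦ ?_⟩
  obtain ⟨δ, hδ⟩ := QuotientGroup.mk_out_eq_mul (CongruenceSubgroup.Gamma0 N) γ⁻¹
  refine ⟨δ, δ.2, _, Finset.mem_image_of_mem _ (Finset.mem_univ
    ((γ⁻¹ : SL(2, ℤ)) : SL(2, ℤ) ⧸ CongruenceSubgroup.Gamma0 N)), ?_⟩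
  rw [hδ]
  group

/-- Modulo 2 and 3 the lower left entry of ρ is only multiplied by the unit δ 1 1. -/
theorem isHalf_mul_iff {δ : SL(2, ℤ)} (hδ : δ ∈ CongruenceSubgroup.Gamma0 18) (ρ : SL(2, ℤ)) :
    IsHalf (δ * ρ) ↔ IsHalf ρ := by
  obtain ⟨k, hk⟩ := mem_Gamma0_18_iff.1 hδ
  have hdet := det_eq_one δ
  have h : (δ * ρ) 1 0 = δ 1 0 * ρ 0 0 + δ 1 1 * ρ 1 0 := by
    simp [Matrix.SpecialLinearGroup.coe_mul, Matrix.mul_apply, Fin.sum_univ_two]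
  have key (p : ℤ) (hp : p ∣ 18) : p ∣ (δ * ρ) 1 0 ↔ p ∣ ρ 1 0 := by
    have hp' : p ∣ δ 1 0 := hk ▸ hp.mul_right k
    have hc : IsCoprime p (δ 1 1) := by
      obtain ⟨j, hj⟩ := hp'
      exact ⟨-(δ 0 1 * j), δ 0 0, by rw [hj] at hdet; linarith⟩
    rw [h, dvd_add_right (hp'.mul_right _)]
    exact ⟨hc.dvd_of_dvd_mul_left, fun h ↦ h.mul_left _⟩
  rw [IsHalf, IsHalf, key 2 (by norm_num), key 3 (by norm_num)]

theorem expansionAtCusp_qParam {N : ℕ} (hN : 0 < N) {f : ℍ → ℂ}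
    (hinv : ∀ γ ∈ CongruenceSubgroup.Gamma0 N, ∀ τ : ℍ, f (γ • τ) = f τ) (γ : SL(2, ℤ)) (τ : ℍ) :
    expansionAtCusp N f γ (Function.Periodic.qParam (cuspWidth N γ) τ) = f (γ • τ) := by
  obtain ⟨h0, hmem⟩ := cuspWidth_mem hN γ
  exact eq_cuspFunction (f := fun τ ↦ f (γ • τ)) τ (by exact_mod_cast h0.ne')
    (periodic_ofComplex (periodic_comp_smul hinv hmem))

theorem tendsto_qParam_cuspWidth {N : ℕ} (hN : 0 < N) (γ : SL(2, ℤ)) :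
    Tendsto (fun τ : ℍ ↦ Function.Periodic.qParam (cuspWidth N γ) τ) atImInfty (𝓝[≠] 0) :=
  tendsto_nhdsWithin_iff.2 ⟨qParam_tendsto_atImInfty (by exact_mod_cast (cuspWidth_mem hN γ).1),
    Eventually.of_forall fun _ ↦ Function.Periodic.qParam_ne_zero _⟩

/-- `g` has at most poles at the cusps of `Γ₀(N)`. -/
def HasModerateGrowth (N : ℕ) (g : ℍ → ℂ) : Prop :=
  ∀ γ : SL(2, ℤ), ∃ n : ℕ, IsBoundedAtImInfty fun τ ↦
    g (γ • τ) * Function.Periodic.qParam (cuspWidth N γ) τ ^ n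

theorem IsModularFunction.hasModerateGrowth {N : ℕ} (hN : 0 < N) {f : ℍ → ℂ}
    (hf : IsModularFunction N f) : HasModerateGrowth N f := by
  intro γ
  obtain ⟨n, hn⟩ := hf.meromorphic_cusps γ
  refine ⟨n, isBoundedAtImInfty_of_tendsto ((hn.continuousAt.tendsto.comp
    ((tendsto_qParam_cuspWidth hN γ).mono_right nhdsWithin_le_nhds)).congr fun τ ↦ ?_)⟩
  simp only [Function.comp_apply, sub_zero, smul_eq_mul]
  rw [expansionAtCusp_qParam hN hf.invariant, mul_comm]

theorem HasModerateGrowth.mul {N : ℕ} {f g : ℍ → ℂ} (hf : HasModerateGrowth N f)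
    (hg : HasModerateGrowth N g) : HasModerateGrowth N (f * g) := by
  intro γ
  obtain ⟨n, hn⟩ := hf γ
  obtain ⟨m, hm⟩ := hg γ
  refine ⟨n + m, ?_⟩
  convert! isBoundedAtImInfty_mul hn hm using 2 with τ
  simp only [Pi.mul_apply]
  ring

theorem IsModularFunction.eval {N : ℕ} {f : ℍ → ℂ} (hf : IsModularFunction N f)
    (P : Polynomial ℂ) : IsModularFunction N fun τ ↦ P.eval (f τ) := by
  induction P using Polynomial.induction_on with
  | C a => simpa using isModularFunction_const N a
  | add p q hp hq =>
    simp only [Polynomial.eval_add]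
    exact hp.add hq
  | monomial n a h =>
    convert! h.mul hf using 2 with τ
    simp only [Polynomial.eval_mul, Polynomial.eval_C, Polynomial.eval_pow, Polynomial.eval_X,
      Pi.mul_apply, pow_succ, mul_assoc]

/-- A holomorphic `Γ₀(18)`-invariant function with at most poles at the cusps is a rational function
of `w`. -/
theorem exists_polynomial_mul_eq {g : ℍ → ℂ}
    (hd : DifferentiableOn ℂ (g ∘ ofComplex) {z : ℂ | 0 < z.im})
    (hinv : ∀ γ ∈ CongruenceSubgroup.Gamma0 18, ∀ τ : ℍ, g (γ • τ) = g τ)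
    (hg : HasModerateGrowth 18 g) :
    ∃ D P : Polynomial ℂ, D ≠ 0 ∧ ∀ τ, g τ * D.eval (w τ) = P.eval (w τ) := by
  obtain ⟨R, hR⟩ := exists_finset_Gamma0_cosets 18
  choose n hn using id hg
  have hL (ρ : SL(2, ℤ)) : ∃ L : ℂ, ¬ IsHalf ρ → (fun τ ↦ w (ρ • τ) - L) =O[atImInfty]
      fun τ ↦ Function.Periodic.qParam (cuspWidth 18 ρ) τ := by
    by_cases hρ : IsHalf ρ
    · exact ⟨0, fun h ↦ absurd hρ h⟩
    · obtain ⟨h0, hmem⟩ := cuspWidth_mem (N := 18) (by norm_num) ρ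
      obtain ⟨L, -, h⟩ := exists_tendsto_of_bounded (f := fun τ ↦ w (ρ • τ))
        (by exact_mod_cast h0 : (0 : ℝ) < cuspWidth 18 ρ)
        (periodic_comp_smul (fun γ hγ τ ↦ w_smul hγ τ) hmem)
        (differentiableOn_comp_smul differentiableOn_w ρ) (isBounded_w_of_not_isHalf hρ)
      exact ⟨L, fun _ ↦ h⟩
  choose L hL using hL
  -- The factor of ρ vanishes at ρ ∞ to order at least n ρ and so compensates the pole of g there;
  -- the other factors stay bounded off the cusp 1/2.
  set D : Polynomial ℂ := ∏ ρ ∈ R, (Polynomial.X - Polynomial.C (L ρ)) ^ n ρ with hD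
  have hDm : IsModularFunction 18 fun τ ↦ D.eval (w τ) := isModularFunction_w.eval D
  have hD0 : D ≠ 0 := Finset.prod_ne_zero_iff.2
    fun ρ _ ↦ pow_ne_zero _ (Polynomial.X_sub_C_ne_zero _)
  have hinv' : ∀ γ ∈ CongruenceSubgroup.Gamma0 18, ∀ τ : ℍ,
      g (γ • τ) * D.eval (w (γ • τ)) = g τ * D.eval (w τ) := fun γ hγ τ ↦ by
    rw [hinv γ hγ, w_smul hγ]
  have hDd : DifferentiableOn ℂ ((fun τ ↦ D.eval (w τ)) ∘ ofComplex) {z : ℂ | 0 < z.im} :=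
    D.differentiable.comp_differentiableOn differentiableOn_w
  obtain ⟨m, hm⟩ := (HasModerateGrowth.mul hg (hDm.hasModerateGrowth (by norm_num))) halfMatrix
  rw [cuspWidth_of_two isHalf_halfMatrix.1 isHalf_halfMatrix.2] at hm
  suffices hb : ∀ γ, ¬ IsHalf γ → IsBoundedAtImInfty fun τ ↦ g (γ • τ) * D.eval (w (γ • τ)) by
    obtain ⟨P, hP⟩ := exists_polynomial_eq (g := fun τ ↦ g τ * D.eval (w τ)) (hd.mul hDd) hinv' hb m
      hm
    exact ⟨D, P, hD0, hP⟩
  intro γ hγ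
  obtain ⟨δ, hδ, ρ, hρ, rfl⟩ := hR γ
  rw [isHalf_mul_iff hδ] at hγ
  simp only [mul_smul, hinv' δ hδ]
  obtain ⟨E, hE⟩ := Finset.dvd_prod_of_mem
    (fun ρ ↦ (Polynomial.X - Polynomial.C (L ρ)) ^ n ρ) hρ
  have h1 : IsBoundedAtImInfty fun τ ↦ g (ρ • τ) * (w (ρ • τ) - L ρ) ^ n ρ :=
    ((Asymptotics.isBigO_refl (fun τ : ℍ ↦ g (ρ • τ)) atImInfty).mul ((hL ρ hγ).pow (n ρ))).trans
      (hn ρ)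
  have h2 := isBoundedAtImInfty_mul h1
    (isBoundedAtImInfty_eval (isBounded_w_of_not_isHalf hγ) E)
  convert! h2 using 2 with τ
  rw [hD, hE]
  simp [mul_assoc]

/-! ### Poles in the upper half plane -/

theorem meromorphicOrderAt_comp_smul (f : ℍ → ℂ) (γ : SL(2, ℤ)) (τ : ℍ) :
    meromorphicOrderAt ((fun τ ↦ f (γ • τ)) ∘ ofComplex) τ =
      meromorphicOrderAt (f ∘ ofComplex) ((γ • τ : ℍ) : ℂ) := by
  have hd := hasDerivAt_moebius γ τ
  have hne : deriv (moebius γ) τ ≠ 0 := by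
    rw [hd.deriv]
    exact one_div_ne_zero (pow_ne_zero _ (denom_ne_zero' γ τ))
  rw [← moebius_coe, ← meromorphicOrderAt_comp_of_deriv_ne_zero (analyticAt_moebius γ τ) hne]
  refine meromorphicOrderAt_congr (Filter.Eventually.filter_mono nhdsWithin_le_nhds ?_)
  filter_upwards [isOpen_im_pos.mem_nhds τ.im_pos] with z hz
  exact comp_smul_ofComplex f γ hz

theorem meromorphicOn_comp_smul {f : ℍ → ℂ}
    (hf : MeromorphicOn (f ∘ ofComplex) {z : ℂ | 0 < z.im}) (γ : SL(2, ℤ)) :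
    MeromorphicOn ((fun τ ↦ f (γ • τ)) ∘ ofComplex) {z : ℂ | 0 < z.im} := by
  intro z hz
  obtain ⟨τ, rfl⟩ : ∃ τ : ℍ, (τ : ℂ) = z := ⟨⟨z, hz⟩, rfl⟩
  have h1 : MeromorphicAt (f ∘ ofComplex) (moebius γ τ) := by
    rw [moebius_coe]
    exact hf _ (γ • τ).im_pos
  refine (h1.comp_analyticAt (analyticAt_moebius γ τ)).congr
    (Filter.Eventually.filter_mono nhdsWithin_le_nhds ?_)
  filter_upwards [isOpen_im_pos.mem_nhds τ.im_pos] with z hz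
  exact (comp_smul_ofComplex f γ hz).symm

/-- A modular function has no poles near a cusp. -/
theorem IsModularFunction.eventually_order_nonneg {N : ℕ} (hN : 0 < N) {f : ℍ → ℂ}
    (hf : IsModularFunction N f) (γ : SL(2, ℤ)) : ∀ᶠ τ : ℍ in atImInfty,
      0 ≤ meromorphicOrderAt ((fun τ ↦ f (γ • τ)) ∘ ofComplex) τ := by
  filter_upwards [(tendsto_qParam_cuspWidth hN γ).eventually
    (hf.meromorphic_cusps γ).eventually_analyticAt] with τ hτ
  have h1 : AnalyticAt ℂ (Function.Periodic.qParam (cuspWidth N γ)) (τ : ℂ) :=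
    Function.Periodic.differentiable_qParam.analyticAt _
  refine ((hτ.comp h1).congr ?_).meromorphicOrderAt_nonneg
  filter_upwards [isOpen_im_pos.mem_nhds τ.im_pos] with z hz
  have := expansionAtCusp_qParam hN hf.invariant γ ⟨z, hz⟩
  rw [Function.comp_apply, Function.comp_apply, ofComplex_apply_of_im_pos hz]
  exact this

/-- Modulo `Γ₀(N)` a modular function has finitely many poles. -/
theorem IsModularFunction.exists_finite_poles {N : ℕ} [NeZero N] {f : ℍ → ℂ}
    (hf : IsModularFunction N f) : ∃ S : Set ℍ, S.Finite ∧ ∀ τ : ℍ,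
      meromorphicOrderAt (f ∘ ofComplex) τ < 0 → ∃ δ ∈ CongruenceSubgroup.Gamma0 N, δ • τ ∈ S := by
  have hN : 0 < N := NeZero.pos N
  obtain ⟨R, hR⟩ := exists_finset_Gamma0_cosets N
  have hfin (ρ : SL(2, ℤ)) : {σ : ℍ | σ ∈ ModularGroup.fd ∧
      meromorphicOrderAt ((fun τ ↦ f (ρ • τ)) ∘ ofComplex) σ < 0}.Finite := by
    -- Above height A there are no poles, and the rest of the fundamental domain is compact, where a
    -- divisor has finite support.
    obtain ⟨A, hA⟩ := (atImInfty_mem _).1 (hf.eventually_order_nonneg hN ρ)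
    have hK := (ModularGroup.isCompact_truncatedFundamentalDomain A).image continuous_coe
    set K : Set ℂ := (↑) '' ModularGroup.truncatedFundamentalDomain A
    have hmer : MeromorphicOn ((fun τ ↦ f (ρ • τ)) ∘ ofComplex) K := by
      rintro _ ⟨σ, -, rfl⟩
      exact meromorphicOn_comp_smul hf.meromorphic ρ σ σ.im_pos
    refine Set.Finite.of_finite_image (f := ((↑) : ℍ → ℂ)) ?_ coe_injective.injOn
    refine ((MeromorphicOn.divisor ((fun τ ↦ f (ρ • τ)) ∘ ofComplex) K).finiteSupport hK).subset ?_
    rintro _ ⟨σ, ⟨hσ, hneg⟩, rfl⟩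
    have hle : σ.im ≤ A := by
      by_contra h
      exact absurd (hA σ (not_le.1 h).le) (not_le.2 hneg)
    have hmem : (σ : ℂ) ∈ K := ⟨σ, ⟨hσ, hle⟩, rfl⟩
    rw [Function.mem_support, MeromorphicOn.divisor_apply hmer hmem]
    lift meromorphicOrderAt ((fun τ ↦ f (ρ • τ)) ∘ ofComplex) σ to ℤ using hneg.ne_top with a ha
    rw [WithTop.untop₀_coe]
    exact_mod_cast hneg.ne
  refine ⟨⋃ ρ ∈ R, (ρ • ·) '' {σ : ℍ | σ ∈ ModularGroup.fd ∧
      meromorphicOrderAt ((fun τ ↦ f (ρ • τ)) ∘ ofComplex) σ < 0},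
    R.finite_toSet.biUnion fun ρ _ ↦ (hfin ρ).image _, fun τ hτ ↦ ?_⟩
  obtain ⟨γ, hγ⟩ := ModularGroup.exists_smul_mem_fd τ
  obtain ⟨δ, hδ, ρ, hρ, h⟩ := hR γ⁻¹
  have hτ' : τ = δ • ρ • γ • τ := by rw [← mul_smul δ, ← h, inv_smul_smul]
  refine ⟨δ⁻¹, inv_mem hδ, Set.mem_biUnion hρ ⟨γ • τ, ⟨hγ, ?_⟩, ?_⟩⟩
  · rw [meromorphicOrderAt_comp_smul]
    have h1 : (fun τ ↦ f (δ • τ)) = f := funext fun τ ↦ hf.invariant δ hδ τ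
    rwa [← h1, meromorphicOrderAt_comp_smul f δ, ← hτ']
  · exact (inv_smul_eq_iff.2 hτ').symm

/-- The function w - w(τ) vanishes at τ, so its n-th power contributes order at least n there. -/
theorem le_meromorphicOrderAt_eval_w {D : Polynomial ℂ} {τ : ℍ} {n : ℕ}
    (h : (Polynomial.X - Polynomial.C (w τ)) ^ n ∣ D) :
    (n : ℤ) ≤ meromorphicOrderAt ((fun τ ↦ D.eval (w τ)) ∘ ofComplex) (τ : ℂ) := by
  obtain ⟨E, rfl⟩ := h
  have hw : AnalyticAt ℂ (w ∘ ofComplex) τ :=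
    differentiableOn_w.analyticAt (isOpen_im_pos.mem_nhds τ.im_pos)
  have hE : AnalyticAt ℂ ((fun τ ↦ E.eval (w τ)) ∘ ofComplex) (τ : ℂ) :=
    (E.differentiable.comp_differentiableOn differentiableOn_w).analyticAt
      (isOpen_im_pos.mem_nhds τ.im_pos)
  have hv : AnalyticAt ℂ (fun z ↦ (w ∘ ofComplex) z - w τ) (τ : ℂ) := hw.sub analyticAt_const
  have h1 : ((1 : ℕ) : ℕ∞) ≤ analyticOrderAt (fun z ↦ (w ∘ ofComplex) z - w τ) (τ : ℂ) := by
    rw [Nat.cast_one, Order.one_le_iff_ne_zero, Ne, hv.analyticOrderAt_eq_zero]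
    simp
  obtain ⟨u, hu, hu'⟩ := (natCast_le_analyticOrderAt hv).1 h1
  set V : ℂ → ℂ :=
    (fun σ ↦ ((Polynomial.X - Polynomial.C (w τ)) ^ n * E).eval (w σ)) ∘ ofComplex with hV
  have hVa : AnalyticAt ℂ V τ := by
    convert! (hv.pow n).mul hE using 1
    ext z
    simp [hV]
  have h2 : (n : ℕ∞) ≤ analyticOrderAt V (τ : ℂ) := by
    refine (natCast_le_analyticOrderAt hVa).2 ⟨_, (hu.pow n).mul hE, ?_⟩
    filter_upwards [hu'] with z hz
    simp only [Function.comp_apply, pow_one, smul_eq_mul] at hz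
    simp [hV, hz, mul_pow, mul_assoc]
  rw [hVa.meromorphicOrderAt_eq]
  induction h : analyticOrderAt V (τ : ℂ) with
  | top => simp
  | coe m =>
    rw [h] at h2
    simp only [ENat.map_natCast]
    exact_mod_cast h2

/-- Every modular function on `Γ₀(18)` becomes holomorphic on `ℍ` after multiplication by a suitable
polynomial in `w`. -/
theorem IsModularFunction.exists_clear_poles {f : ℍ → ℂ} (hf : IsModularFunction 18 f) :
    ∃ D : Polynomial ℂ, D ≠ 0 ∧ ∀ τ : ℍ,
      0 ≤ meromorphicOrderAt ((fun τ ↦ f τ * D.eval (w τ)) ∘ ofComplex) (τ : ℂ) := by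
  obtain ⟨S, hS, hpole⟩ := hf.exists_finite_poles
  -- At a pole this is the pole order; at any other point of S it only adds harmless zeros.
  set n : ℍ → ℕ := fun σ ↦ (meromorphicOrderAt (f ∘ ofComplex) (σ : ℂ)).untop₀.natAbs with hn
  set D : Polynomial ℂ :=
    ∏ σ ∈ hS.toFinset, (Polynomial.X - Polynomial.C (w σ)) ^ n σ with hD
  have hDa (τ : ℍ) : AnalyticAt ℂ ((fun τ ↦ D.eval (w τ)) ∘ ofComplex) (τ : ℂ) :=
    (D.differentiable.comp_differentiableOn differentiableOn_w).analyticAt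
      (isOpen_im_pos.mem_nhds τ.im_pos)
  refine ⟨D, Finset.prod_ne_zero_iff.2 fun ρ _ ↦ pow_ne_zero _ (Polynomial.X_sub_C_ne_zero _),
    fun τ ↦ ?_⟩
  have hmul := meromorphicOrderAt_mul (hf.meromorphic τ τ.im_pos) (hDa τ).meromorphicAt
  change 0 ≤ meromorphicOrderAt ((f ∘ ofComplex) * ((fun τ ↦ D.eval (w τ)) ∘ ofComplex)) (τ : ℂ)
  rw [hmul]
  rcases le_or_gt 0 (meromorphicOrderAt (f ∘ ofComplex) (τ : ℂ)) with h0 | h0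
  · exact add_nonneg h0 (hDa τ).meromorphicOrderAt_nonneg
  obtain ⟨δ, hδ, hmem⟩ := hpole τ h0
  have h1 : meromorphicOrderAt (f ∘ ofComplex) ((δ • τ : ℍ) : ℂ) =
      meromorphicOrderAt (f ∘ ofComplex) (τ : ℂ) := by
    rw [← meromorphicOrderAt_comp_smul, funext fun τ ↦ hf.invariant δ hδ τ]
  -- The factor of D belongs to the representative δ τ, but w(δ τ) = w(τ), so it vanishes at τ as
  -- well.
  have h2 : (n (δ • τ) : ℤ) ≤ meromorphicOrderAt ((fun τ ↦ D.eval (w τ)) ∘ ofComplex) (τ : ℂ) := by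
    apply le_meromorphicOrderAt_eval_w
    rw [← w_smul hδ]
    exact Finset.dvd_prod_of_mem (fun σ ↦ (Polynomial.X - Polynomial.C (w σ)) ^ n σ)
      (hS.mem_toFinset.2 hmem)
  refine le_trans ?_ (add_le_add_right h2 _)
  simp only [hn, h1]
  lift meromorphicOrderAt (f ∘ ofComplex) (τ : ℂ) to ℤ using h0.ne_top with a ha
  rw [WithTop.untop₀_coe]
  have h0' : a < 0 := by exact_mod_cast h0
  have : (0 : ℤ) ≤ a + (a.natAbs : ℤ) := by omega
  exact_mod_cast this

/-- A modular function without poles on `ℍ` agrees outside a discrete set with a holomorphic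
one. -/
theorem IsModularFunction.exists_holomorphic {N : ℕ} (hN : 0 < N) {f : ℍ → ℂ}
    (hf : IsModularFunction N f)
    (hord : ∀ τ : ℍ, 0 ≤ meromorphicOrderAt (f ∘ ofComplex) (τ : ℂ)) :
    ∃ g : ℍ → ℂ, DifferentiableOn ℂ (g ∘ ofComplex) {z : ℂ | 0 < z.im} ∧
      (∀ γ ∈ CongruenceSubgroup.Gamma0 N, ∀ τ : ℍ, g (γ • τ) = g τ) ∧
      HasModerateGrowth N g ∧ ∀ᶠ τ in codiscrete ℍ, f τ = g τ := by
  set U : Set ℂ := {z : ℂ | 0 < z.im} with hU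
  -- The normal form fills in the removable singularities.
  set G := toMeromorphicNFOn (f ∘ ofComplex) U with hG
  have hGa (τ : ℍ) : AnalyticAt ℂ G τ := by
    rw [← (meromorphicNFOn_toMeromorphicNFOn (f ∘ ofComplex) U
      τ.im_pos).meromorphicOrderAt_nonneg_iff_analyticAt,
      meromorphicOrderAt_toMeromorphicNFOn hf.meromorphic τ.im_pos]
    exact hord τ
  have hGf (τ : ℍ) : G =ᶠ[𝓝[≠] (τ : ℂ)] f ∘ ofComplex :=
    hf.meromorphic.toMeromorphicNFOn_eq_self_on_nhdsNE τ.im_pos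
  have hlim (τ : ℍ) : Tendsto (f ∘ ofComplex) (𝓝[≠] (τ : ℂ)) (𝓝 (G τ)) :=
    ((hGa τ).continuousAt.tendsto.mono_left nhdsWithin_le_nhds).congr' (hGf τ)
  have hpos (τ : ℍ) : ∀ᶠ z in 𝓝[≠] (τ : ℂ), 0 < z.im :=
    nhdsWithin_le_nhds (isOpen_im_pos.mem_nhds τ.im_pos)
  -- Values of G are punctured limits of f, so invariance and bounds pass from f to G at every
  -- point.
  have hlim' (γ : SL(2, ℤ)) (τ : ℍ) :
      Tendsto (fun z ↦ f (γ • ofComplex z)) (𝓝[≠] (τ : ℂ)) (𝓝 (G (γ • τ : ℍ))) := by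
    have h1 := (hasDerivAt_moebius γ τ).tendsto_nhdsNE
      (one_div_ne_zero (pow_ne_zero _ (denom_ne_zero' γ τ)))
    rw [moebius_coe] at h1
    refine ((hlim (γ • τ)).comp h1).congr' ?_
    filter_upwards [hpos τ] with z hz
    exact (comp_smul_ofComplex f γ hz).symm
  refine ⟨fun τ ↦ G τ, ?_, fun γ hγ τ ↦ ?_, fun γ ↦ ?_, eventually_codiscrete_iff.2 fun τ ↦ ?_⟩
  · refine DifferentiableOn.congr (f := G) (fun z hz ↦ ?_) fun z hz ↦ ?_
    · exact (hGa ⟨z, hz⟩).differentiableAt.differentiableWithinAt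
    · rw [Function.comp_apply, ofComplex_apply_of_im_pos hz]
  · have h1 := hlim' γ τ
    simp only [hf.invariant γ hγ] at h1
    exact tendsto_nhds_unique h1 (hlim τ)
  · obtain ⟨n, hn⟩ := hf.hasModerateGrowth hN γ
    obtain ⟨M, A, hA⟩ := isBoundedAtImInfty_iff.1 hn
    -- Raising the height by 1 leaves a neighbourhood of τ above A, on which the bound for f
    -- applies.
    refine ⟨n, isBoundedAtImInfty_iff.2 ⟨M, A + 1, fun τ hτ ↦ ?_⟩⟩
    have hq : Tendsto (Function.Periodic.qParam (cuspWidth N γ)) (𝓝[≠] (τ : ℂ))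
        (𝓝 (Function.Periodic.qParam (cuspWidth N γ) τ)) :=
      (Function.Periodic.differentiable_qParam.continuous.tendsto _).mono_left nhdsWithin_le_nhds
    refine le_of_tendsto ((hlim' γ τ).mul (hq.pow n)).norm ?_
    have hgt : ∀ᶠ z in 𝓝[≠] (τ : ℂ), A < z.im :=
      nhdsWithin_le_nhds ((isOpen_lt continuous_const Complex.continuous_im).mem_nhds
        (show A < (τ : ℂ).im from (lt_add_one A).trans_le hτ))
    filter_upwards [hpos τ, hgt] with z hz hz'
    rw [ofComplex_apply_of_im_pos hz]
    exact hA ⟨z, hz⟩ hz'.le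
  · filter_upwards [hGf τ, hpos τ] with z hz hz'
    rw [Function.comp_apply] at hz
    rw [← hz, ofComplex_apply_of_im_pos hz']

/-! ### Generation of the function field -/

theorem tendsto_w_atImInfty : Tendsto w atImInfty (𝓝[≠] 0) := by
  refine tendsto_nhdsWithin_iff.2 ⟨?_, Eventually.of_forall w_ne_zero⟩
  obtain ⟨C, -, hC⟩ := hasLeading_w_one (γ := 1) (by simp)
  have h := hC.mul (qParam_tendsto_atImInfty zero_lt_one)
  rw [mul_zero] at h
  refine h.congr fun τ ↦ ?_
  simp only [one_smul, Function.Periodic.qParam]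
  rw [mul_assoc, ← Complex.exp_add]
  simp

/-- Near i∞, w tends to 0 through nonzero values and so avoids the finitely many roots of D. Hence
D(w) is nonzero at some point and, by continuity, around it. -/
theorem not_eventually_eval_w_eq_zero {D : Polynomial ℂ} (hD : D ≠ 0) :
    ¬ ∀ᶠ τ in codiscrete ℍ, D.eval (w τ) = 0 := by
  intro h
  have h1 : ∀ᶠ v in 𝓝[≠] (0 : ℂ), D.eval v ≠ 0 := by
    have hfin : (D.rootSet ℂ \ {0}).Finite := (D.rootSet_finite ℂ).subset Set.sdiff_subset
    filter_upwards [nhdsWithin_le_nhds (hfin.isClosed.compl_mem_nhds (by simp)),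
      self_mem_nhdsWithin] with v hv hv0 hv'
    exact hv ⟨Polynomial.mem_rootSet.2 ⟨hD, by simpa using hv'⟩, hv0⟩
  obtain ⟨τ, hτ⟩ := (tendsto_w_atImInfty.eventually h1).exists
  have hc : ContinuousAt ((fun τ ↦ D.eval (w τ)) ∘ ofComplex) (τ : ℂ) :=
    ((D.differentiable.comp_differentiableOn differentiableOn_w).differentiableAt
      (isOpen_im_pos.mem_nhds τ.im_pos)).continuousAt
  have h2 := hc.eventually_ne (y := 0) (by simpa using hτ)
  obtain ⟨z, hz, hz'⟩ :=
    ((h2.filter_mono nhdsWithin_le_nhds).and (eventually_codiscrete_iff.1 h τ)).exists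
  exact hz hz'

theorem aeval_toField {N : ℕ} {f : ℍ → ℂ} (hf : IsModularFunction N f) (P : Polynomial ℂ) :
    Polynomial.aeval hf.toField P = (hf.eval P).toField := by
  induction P using Polynomial.induction_on with
  | C a =>
    rw [Polynomial.aeval_C]
    apply Subtype.ext
    change algebraMap ℂ FunModDiscrete a = _
    rw [Algebra.algebraMap_eq_smul_one]
    exact congrArg (fun u : ℍ → ℂ ↦ (u : FunModDiscrete)) (by ext; simp)
  | add p q hp hq =>
    rw [map_add, hp, hq]
    exact Subtype.ext (congrArg (fun u : ℍ → ℂ ↦ (u : FunModDiscrete)) (by ext; simp))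
  | monomial n a h =>
    rw [pow_succ, ← mul_assoc, map_mul, h, Polynomial.aeval_X]
    exact Subtype.ext (congrArg (fun u : ℍ → ℂ ↦ (u : FunModDiscrete)) (by ext; simp))

/-- Every modular function on `Γ₀(18)` is a rational function of `w`. -/
theorem IsModularFunction.exists_rational {f : ℍ → ℂ} (hf : IsModularFunction 18 f) :
    ∃ D P : Polynomial ℂ, D ≠ 0 ∧ ∀ᶠ τ in codiscrete ℍ, f τ * D.eval (w τ) = P.eval (w τ) := by
  obtain ⟨D₁, hD₁, hord⟩ := hf.exists_clear_poles
  obtain ⟨g, hd, hinv, hg, hfg⟩ :=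
    (hf.mul (isModularFunction_w.eval D₁)).exists_holomorphic (by norm_num) hord
  obtain ⟨D₂, P, hD₂, hP⟩ := exists_polynomial_mul_eq hd hinv hg
  refine ⟨D₁ * D₂, P, mul_ne_zero hD₁ hD₂, ?_⟩
  filter_upwards [hfg] with τ hτ
  rw [← hP, ← hτ, Polynomial.eval_mul, Pi.mul_apply, mul_assoc]

theorem adjoin_w_eq_top : IntermediateField.adjoin ℂ {isModularFunction_w.toField} = ⊤ := by
  refine eq_top_iff.2 fun x _ ↦ ?_
  obtain ⟨_, f, hf, rfl⟩ := x
  obtain ⟨D, P, hD, h⟩ := hf.exists_rational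
  have hmem (Q : Polynomial ℂ) : Polynomial.aeval isModularFunction_w.toField Q ∈
      IntermediateField.adjoin ℂ {isModularFunction_w.toField} :=
    IntermediateField.algebra_adjoin_le_adjoin _ _ (Polynomial.aeval_mem_adjoin_singleton _ _)
  have hD0 : Polynomial.aeval isModularFunction_w.toField D ≠ 0 := fun h0 ↦ by
    rw [aeval_toField] at h0
    exact not_eventually_eval_w_eq_zero hD (Germ.coe_eq.1 (congrArg Subtype.val h0))
  have hmul : hf.toField * Polynomial.aeval isModularFunction_w.toField D =
      Polynomial.aeval isModularFunction_w.toField P := by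
    rw [aeval_toField, aeval_toField]
    exact Subtype.ext (Germ.coe_eq.2 h)
  have := div_mem (hmem P) (hmem D)
  rw [← hmul, mul_div_cancel_right₀ _ hD0] at this
  exact this

end OrderSix

end

theorem theorem1 :
    -- the continued fraction converges on the upper half plane, to its product expansion
    (∀ τ : ℍ, Tendsto (OrderSix.approxX τ) atTop (𝓝 (OrderSix.X τ)) ∧
      Multipliable (fun n : ℕ ↦ OrderSix.factorX τ (n + 1)) ∧
      OrderSix.X τ = OrderSix.qPow τ (1 / 4) * ∏' n : ℕ, OrderSix.factorX τ (n + 1)) ∧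
    -- `w` is an eta-quotient
    (∀ τ : ℍ, OrderSix.w τ =
      ModularForm.eta τ * ModularForm.eta (18 * τ) ^ 2 /
        (ModularForm.eta (2 * τ) ^ 2 * ModularForm.eta (9 * τ))) ∧
    -- `w` is a modular function on `Γ₀(18)` that generates the field of all of them
    ∃ hw : OrderSix.IsModularFunction 18 OrderSix.w,
      IntermediateField.adjoin ℂ {hw.toField} = ⊤ ∧
      -- `w` has neither poles nor zeros on the upper half plane
      DifferentiableOn ℂ (OrderSix.w ∘ ofComplex) {z : ℂ | 0 < z.im} ∧
      (∀ τ : ℍ, OrderSix.w τ ≠ 0) ∧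
      -- the orders of `w` at the cusps
      ∀ r : OnePoint ℚ,
        (OrderSix.CuspEquiv 18 OnePoint.infty r → OrderSix.HasOrderAtCusp 18 OrderSix.w r 1) ∧
        (OrderSix.CuspEquiv 18 ((1 / 2 : ℚ) : OnePoint ℚ) r →
          OrderSix.HasOrderAtCusp 18 OrderSix.w r (-1)) ∧
        (¬ OrderSix.CuspEquiv 18 OnePoint.infty r →
          ¬ OrderSix.CuspEquiv 18 ((1 / 2 : ℚ) : OnePoint ℚ) r →
          OrderSix.HasOrderAtCusp 18 OrderSix.w r 0) := by
  refine ⟨fun τ ↦ ?_, OrderSix.w_eq_eta, OrderSix.isModularFunction_w,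
    OrderSix.adjoin_w_eq_top, OrderSix.differentiableOn_w,
    OrderSix.w_ne_zero, OrderSix.hasOrderAtCusp_w⟩
  rw [OrderSix.X_eq_prodX τ.im_pos]
  exact ⟨OrderSix.tendsto_approxX τ.im_pos, (OrderSix.hasProd_factorX τ.im_pos).multipliable,
    OrderSix.prodX_eq_tprod τ.im_pos⟩
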